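/- Let $\mathbf M=\{M_1,\dots,M_m\}$ be a POVM on $\mathbb C^d$ (that is, $M_i\ge 0$ and $\sum_i M_i=\mathbf 1$), and let $\rho$ be a density matrix on $\mathbb C^d$. For a projection-valued measure $\mathbf P=\{P_i\}$ and a state $\varrho$ put $\Delta_{\mathbf P}(\varrho)=\sum_i P_i\varrho P_i$. Let $R(\varrho,\mathbf P)$ be either one of the two randomness functions $$R_c(\varrho,\mathbf P)=\min_{\varrho=\sum_j q_j|\psi_j\rangle\langle\psi_j|}\ \sum_j q_j\,S\bigl(\Delta_{\mathbf P}(|\psi_j\rangle\langle\psi_j|)\bigr),\qquad R_q(\varrho,\mathbf P)=S\bigl(\varrho\,\|\,\Delta_{\mathbf P}(\varrho)\bigr),$$ where $S(\varrho)=-\operatorname{tr}(\varrho\log_2\varrho)$, $S(\varrho\|\sigma)=\operatorname{tr}(\varrho\log_2\varrho-\varrho\log_2\sigma)$, and the minimum is over finite decompositions into pure states with $q_j\ge0$, $\sum_jq_j=1$. A POVM is extremal if it is an extreme point of the convex set of POVMs. For an extremal POVM $\mathbf N=\{N_1,\dots,N_m\}$ put $R(\rho,\mathbf N)=R(\rho\otimes|1\rangle\langle1|,\mathbf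 P_c)$, where $\mathbf P_c$ is a canonical Naimark extension of $\mathbf N$: $P_i=U^\dagger(\mathbf 1\otimes|i\rangle\langle i|)U$ with $U$ a unitary on $\mathbb C^d\otimes\mathbb C^m$ such that $N_i=\operatorname{tr}_{\mathbb C^m}[P_i(\mathbf 1\otimes|1\rangle\langle1|)]$ for all $i$ (the value does not depend on the choice of $U$). An extremal decomposition of $\mathbf M$ is a finite convex combination $\mathbf M=\sum_j r_j\mathbf N^j$ with $r_j>0$, $\sum_j r_j=1$ and every $\mathbf N^j$ extremal, and $$R^{\rm cf}(\rho,\mathbf M)=\min_{\{r_j,\mathbf N^j\}}\ \sum_j r_j\,R(\rho,\mathbf N^j),$$ the minimum being over all extremal decompositions of $\mathbf M$. Then $R^{\rm cf}(\rho,\mathbf M)=0$ if and only if $\mathbf M$ has an extremal decomposition $\mathbf M=\sum_j r_j\mathbf N^j$ that satisfies one of the following two conditions, which are equivalent for every extremal decomposition of $\mathbf M$: 1. $N^j_i\,\rho\,N^j_{i'}=0$ for all $j$ and all $i\ne i'$; 2. for each $j$, the state has a spectral decomposition $\rho=\sum_k q^j_k|\psi^j_k\rangle\langle\psi^j_k|$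 (with $q^j_k>0$ and $\{\psi^j_k\}_k$ orthonormal) such that for every $k$ there is an $i$ with $N^j_i|\psi^j_k\rangle=|\psi^j_k\rangle$. -/

import Mathlib

open scoped Matrix Kronecker ComplexOrder

noncomputable section

namespace POVMRandomness

/-- A density matrix: positive semidefinite with unit trace. -/
def IsState {n : Type*} [Fintype n] (ρ : Matrix n n ℂ) : Prop :=
  ρ.PosSemidef ∧ ρ.trace = 1

/-- The rank-one operator `|ψ⟩⟨ψ|`. -/
def ketbra {n : Type*} (ψ : n → ℂ) : Matrix n n ℂ :=
  Matrix.vecMulVec ψ (star ψ)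

/-- A POVM: a family of positive semidefinite matrices which sums to the identity. -/
def IsPOVM {n ι : Type*} [Fintype n] [DecidableEq n] [Fintype ι]
    (M : ι → Matrix n n ℂ) : Prop :=
  (∀ i, (M i).PosSemidef) ∧ ∑ i, M i = 1

/-- An extremal POVM: an extreme point of the convex set of POVMs. It suffices to compare with
POVMs that have the same set of outcomes: if `N = λ M' + (1 - λ) M''` with `0 < λ < 1`, then `M'`
and `M''` vanish at every outcome at which `N` vanishes. -/
def IsExtremalPOVM {n ι : Type*} [Fintype n] [DecidableEq n] [Fintype ι]
    (N : ι → Matrix n n ℂ) : Prop :=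
  N ∈ Set.extremePoints ℝ {M : ι → Matrix n n ℂ | IsPOVM M}

/-- `M = ∑ j, r j • N j` is a finite convex decomposition of `M` into extremal POVMs. -/
def IsExtremalDecomposition {n ι : Type*} [Fintype n] [DecidableEq n] [Fintype ι]
    (M : ι → Matrix n n ℂ) {l : ℕ} (r : Fin l → ℝ) (N : Fin l → ι → Matrix n n ℂ) : Prop :=
  (∀ j, 0 < r j) ∧ ∑ j, r j = 1 ∧ (∀ j, IsExtremalPOVM (N j)) ∧ ∀ i, M i = ∑ j, r j • N j i

/-- The binary logarithm `log ρ` of a Hermitian matrix, with the convention `log 0 = 0` on the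
kernel. -/
def matrixLog {n : Type*} [Fintype n] [DecidableEq n] (ρ : Matrix n n ℂ) : Matrix n n ℂ :=
  cfc (Real.logb 2) ρ

/-- The von Neumann entropy `S(ρ) = - tr (ρ log ρ)`. -/
def entropy {n : Type*} [Fintype n] [DecidableEq n] (ρ : Matrix n n ℂ) : ℝ :=
  -((ρ * matrixLog ρ).trace).re

/-- The quantum relative entropy `S(ρ‖σ) = tr (ρ log ρ - ρ log σ)`, for `ker σ ⊆ ker ρ`. -/
def relEntropy {n : Type*} [Fintype n] [DecidableEq n] (ρ σ : Matrix n n ℂ) : ℝ :=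
  ((ρ * matrixLog ρ - ρ * matrixLog σ).trace).re

/-- The block-dephasing operation `Δ_P(ρ) = ∑ i, P i ρ P i`. -/
def dephase {n ι : Type*} [Fintype n] [Fintype ι] (P : ι → Matrix n n ℂ)
    (ρ : Matrix n n ℂ) : Matrix n n ℂ :=
  ∑ i, P i * ρ * P i

/-- `ρ = ∑ j, q j |ψ j⟩⟨ψ j|` is a finite decomposition of `ρ` into pure states. -/
def IsPureDecomposition {n : Type*} [Fintype n] (ρ : Matrix n n ℂ) {l : ℕ}
    (q : Fin l → ℝ) (ψ : Fin l → n → ℂ) : Prop :=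
  (∀ j, 0 ≤ q j) ∧ ∑ j, q j = 1 ∧ (∀ j, star (ψ j) ⬝ᵥ ψ j = 1) ∧ ρ = ∑ j, q j • ketbra (ψ j)

/-- The convex-roof randomness function of a PVM,
`R_c(ρ, P) = min ∑ j, q j S(Δ_P(|ψ j⟩⟨ψ j|))` over the pure state decompositions of `ρ`. -/
def Rc {n ι : Type*} [Fintype n] [DecidableEq n] [Fintype ι]
    (ρ : Matrix n n ℂ) (P : ι → Matrix n n ℂ) : ℝ :=
  sInf {x : ℝ | ∃ (l : ℕ) (q : Fin l → ℝ) (ψ : Fin l → n → ℂ),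
    IsPureDecomposition ρ q ψ ∧ x = ∑ j, q j * entropy (dephase P (ketbra (ψ j)))}

/-- The relative-entropy randomness function of a PVM, `R_q(ρ, P) = S(ρ‖Δ_P(ρ))`. For a PVM `P`
and a state `ρ`, the kernel of `Δ_P(ρ)` is always contained in that of `ρ`. -/
def Rq {n ι : Type*} [Fintype n] [DecidableEq n] [Fintype ι]
    (ρ : Matrix n n ℂ) (P : ι → Matrix n n ℂ) : ℝ :=
  relEntropy ρ (dephase P ρ)

/-- The partial trace over the second tensor factor. -/
def partialTrace {n k : Type*} [Fintype k] (X : Matrix (n × k) (n × k) ℂ) : Matrix n n ℂ :=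
  Matrix.of fun a b => ∑ q, X (a, q) (b, q)

/-- The projectors `P i = U† (1 ⊗ |i⟩⟨i|) U` on `A ⊗ Q`. -/
def naimarkPVM {n : Type*} [Fintype n] [DecidableEq n] {m : ℕ}
    (U : Matrix (n × Fin m) (n × Fin m) ℂ) (i : Fin m) : Matrix (n × Fin m) (n × Fin m) ℂ :=
  Uᴴ * ((1 : Matrix n n ℂ) ⊗ₖ Matrix.single i i (1 : ℂ)) * U

/-- The pure ancillary state: the projector on the first basis vector of `Q`. -/
def ancilla (m : ℕ) [NeZero m] : Matrix (Fin m) (Fin m) ℂ :=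
  Matrix.single 0 0 1

/-- The unitary `U` gives a canonical Naimark extension of `N`: the ancillary space has one
dimension per outcome, and the consistency condition `N i = tr_Q [P i (1 ⊗ |0⟩⟨0|)]` holds. -/
def IsCanonicalExtension {n : Type*} [Fintype n] [DecidableEq n] {m : ℕ} [NeZero m]
    (N : Fin m → Matrix n n ℂ) (U : Matrix (n × Fin m) (n × Fin m) ℂ) : Prop :=
  U ∈ Matrix.unitaryGroup (n × Fin m) ℂ ∧
    ∀ i, N i = partialTrace (naimarkPVM U i * ((1 : Matrix n n ℂ) ⊗ₖ ancilla m))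

/-- The randomness `R(ρ, N) = R(ρ ⊗ |0⟩⟨0|, P_c)` of a POVM, computed in a canonical Naimark
extension `P_c` of `N`, for a randomness function `R` of PVMs. A POVM has many canonical
extensions; the infimum makes no choice among them. -/
def canonicalRandomness {n : Type*} [Fintype n] [DecidableEq n] {m : ℕ} [NeZero m]
    (R : Matrix (n × Fin m) (n × Fin m) ℂ → (Fin m → Matrix (n × Fin m) (n × Fin m) ℂ) → ℝ)
    (ρ : Matrix n n ℂ) (N : Fin m → Matrix n n ℂ) : ℝ :=
  sInf {x : ℝ | ∃ U : Matrix (n × Fin m) (n × Fin m) ℂ,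
    IsCanonicalExtension N U ∧ x = R (ρ ⊗ₖ ancilla m) (naimarkPVM U)}

/-- The convex-roof randomness `R^cf(ρ, M) = min ∑ j, r j R(ρ, N j)` of a POVM, over its
extremal decompositions. -/
def Rcf {n : Type*} [Fintype n] [DecidableEq n] {m : ℕ} [NeZero m]
    (R : Matrix (n × Fin m) (n × Fin m) ℂ → (Fin m → Matrix (n × Fin m) (n × Fin m) ℂ) → ℝ)
    (ρ : Matrix n n ℂ) (M : Fin m → Matrix n n ℂ) : ℝ :=
  sInf {x : ℝ | ∃ (l : ℕ) (r : Fin l → ℝ) (N : Fin l → Fin m → Matrix n n ℂ),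
    IsExtremalDecomposition M r N ∧ x = ∑ j, r j * canonicalRandomness R ρ (N j)}

/-- `ρ = ∑ k, q k |ψ k⟩⟨ψ k|` is a spectral decomposition of `ρ`: the `q k` are the positive
eigenvalues, with multiplicity, and the `ψ k` are orthonormal eigenvectors. -/
def IsSpectralDecomposition {n : Type*} [Fintype n] (ρ : Matrix n n ℂ) {l : ℕ}
    (q : Fin l → ℝ) (ψ : Fin l → n → ℂ) : Prop :=
  (∀ k, 0 < q k) ∧ (∀ k k', star (ψ k) ⬝ᵥ ψ k' = if k = k' then 1 else 0) ∧
    ρ = ∑ k, q k • ketbra (ψ k)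

/-- `N j i ρ N j i' = 0` for all `j` and all `i ≠ i'`. -/
def CrossTermsVanish {n ι : Type*} [Fintype n] (ρ : Matrix n n ℂ) {l : ℕ}
    (N : Fin l → ι → Matrix n n ℂ) : Prop :=
  ∀ j i i', i ≠ i' → N j i * ρ * N j i' = 0

/-- For each `j`, some spectral decomposition of `ρ` consists of vectors each of which is a
`+1` eigenvector of some element of `N j`. -/
def SpectralPlusOne {n ι : Type*} [Fintype n] (ρ : Matrix n n ℂ) {l : ℕ}
    (N : Fin l → ι → Matrix n n ℂ) : Prop :=
  ∀ j, ∃ (s : ℕ) (q : Fin s → ℝ) (ψ : Fin s → n → ℂ),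
    IsSpectralDecomposition ρ q ψ ∧ ∀ k, ∃ i, N j i *ᵥ ψ k = ψ k

end POVMRandomness

end

/-! Both randomness functions control the squared Frobenius distance between a state and its
dephased version: Klein's inequality with a quadratic remainder gives this for `Rq`, and convexity
carries it from pure states to `Rc`. Compressing a Naimark extension turns that distance into a
bound on the cross terms, so `crossDefect` is at most a constant times `canonicalRandomness`,
uniformly in the POVM (`exists_crossDefect_le`).

Attainment of the infimum is not needed. If `M` lies outside the compact convex hull of the
cross-free POVMs, a separating functional bounds the average defect of its decompositions away from
zero (`exists_pos_le_sum_crossDefect`), hence also `Rcf`. If `M` lies inside, Minkowski's theorem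
splits each cross-free POVM into extremal ones, and these are again cross-free.

Conversely, vanishing cross terms make the operators `N i * ρ` positive, mutually orthogonal and of
sum `ρ`. Their eigenvectors are `+1` eigenvectors of the `N i`, remain fixed by the dilated
projections, and so carry no randomness. -/

/-! ### Minkowski's theorem and compactness of convex hulls -/

section FiniteDimensionalConvexity

variable {E : Type*} [AddCommGroup E] [Module ℝ E]

/-- The subspace of directions in which one can move both ways from `x` inside `s`. -/
def Convex.faceDirection {s : Set E} (hs : Convex ℝ s) {x : E} (hx : x ∈ s) : Submodule ℝ E where
  carrier := {D | ∃ ε : ℝ, 0 < ε ∧ x + ε • D ∈ s ∧ x - ε • D ∈ s}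
  zero_mem' := ⟨1, one_pos, by simpa using hx, by simpa using hx⟩
  add_mem' := by
    rintro D D' ⟨ε, hε, h1, h2⟩ ⟨δ, hδ, h3, h4⟩
    have hsum : ε + δ ≠ 0 := by positivity
    -- This step size makes the new point the average of `x ± ε • D` and `x ± δ • D'` with weights
    -- `δ / (ε + δ)` and `ε / (ε + δ)`.
    refine ⟨ε * δ / (ε + δ), by positivity, ?_, ?_⟩
    · convert hs h1 h3 (a := δ / (ε + δ)) (b := ε / (ε + δ)) (by positivity) (by positivity)
        (by field_simp; ring) using 1
      match_scalars <;> field_simp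
      ring
    · convert hs h2 h4 (a := δ / (ε + δ)) (b := ε / (ε + δ)) (by positivity) (by positivity)
        (by field_simp; ring) using 1
      match_scalars <;> field_simp
      ring
  smul_mem' := by
    rintro c D ⟨ε, hε, h1, h2⟩
    rcases lt_trichotomy c 0 with hc | rfl | hc
    · have hc' : 0 < -c := by linarith
      refine ⟨ε / (-c), by positivity, ?_, ?_⟩
      · convert h2 using 1
        rw [smul_smul, div_neg, neg_mul, div_mul_cancel₀ _ hc.ne]
        module
      · convert h1 using 1
        rw [smul_smul, div_neg, neg_mul, div_mul_cancel₀ _ hc.ne]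
        module
    · exact ⟨1, one_pos, by simpa using hx, by simpa using hx⟩
    · refine ⟨ε / c, by positivity, ?_, ?_⟩
      · rwa [smul_smul, show ε / c * c = ε by field_simp]
      · rwa [smul_smul, show ε / c * c = ε by field_simp]

/-- Averaging `x + t • D ± ε • D'` with `x - δ • D` gives `x` plus or minus a multiple of `D'`, so
no direction is gained; `D` itself is lost by maximality of `t`. This strict drop drives the
induction on dimension. -/
theorem Convex.faceDirection_lt {s : Set E} (hs : Convex ℝ s) {x D : E} (hx : x ∈ s) {t : ℝ}
    (hD : D ∈ hs.faceDirection hx) (ht : 0 ≤ t) (hy : x + t • D ∈ s)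
    (hmax : ∀ u : ℝ, x + u • D ∈ s → u ≤ t) :
    hs.faceDirection hy < hs.faceDirection hx := by
  refine lt_of_le_of_ne ?_ ?_
  · obtain ⟨δ, hδ, -, h2⟩ := hD
    rintro D' ⟨ε, hε, h3, h4⟩
    have hsum : t + δ ≠ 0 := by positivity
    refine ⟨δ / (t + δ) * ε, by positivity, ?_, ?_⟩
    · convert hs h3 h2 (a := δ / (t + δ)) (b := t / (t + δ)) (by positivity) (by positivity)
        (by field_simp; ring) using 1
      match_scalars <;> field_simp <;> ring
    · convert hs h4 h2 (a := δ / (t + δ)) (b := t / (t + δ)) (by positivity) (by positivity)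
        (by field_simp; ring) using 1
      match_scalars <;> field_simp <;> ring
  · intro h
    rw [← h] at hD
    obtain ⟨ε, hε, h1, -⟩ := hD
    have := hmax (t + ε) (by rw [add_smul, ← add_assoc]; exact h1)
    linarith

variable [TopologicalSpace E] [IsTopologicalAddGroup E] [ContinuousSMul ℝ E]

theorem IsCompact.exists_max_ray [T2Space E] {s : Set E} (hs : IsCompact s) {x D : E} (hx : x ∈ s)
    (hD : D ≠ 0) : ∃ t : ℝ, 0 ≤ t ∧ x + t • D ∈ s ∧ ∀ u : ℝ, x + u • D ∈ s → u ≤ t := by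
  have hemb : Topology.IsClosedEmbedding (fun t : ℝ => x + t • D) :=
    (Homeomorph.addLeft x).isClosedEmbedding.comp
      (LinearMap.isClosedEmbedding_of_injective (𝕜 := ℝ) (f := LinearMap.toSpanSingleton ℝ E D)
        (LinearMap.ker_toSpanSingleton ℝ hD))
  have hc := hemb.isCompact_preimage hs
  obtain ⟨t, ht, hmax⟩ := hc.exists_isMaxOn ⟨0, by simpa using hx⟩ continuousOn_id
  exact ⟨t, hmax (show (0 : ℝ) ∈ _ by simpa using hx), ht, fun u hu => hmax hu⟩

variable [FiniteDimensional ℝ E]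

/-- Minkowski's theorem: a compact convex set in a finite-dimensional space is the convex hull of
its extreme points. -/
theorem IsCompact.subset_convexHull_extremePoints [T2Space E] {s : Set E} (hc : IsCompact s)
    (hs : Convex ℝ s) : s ⊆ convexHull ℝ (s.extremePoints ℝ) := by
  suffices h : ∀ (k : ℕ) (x : E) (hx : x ∈ s),
      Module.finrank ℝ (hs.faceDirection hx) = k → x ∈ convexHull ℝ (s.extremePoints ℝ) from
    fun x hx => h _ x hx rfl
  intro k
  induction k using Nat.strong_induction_on with
  | _ k ih =>
    intro x hx hk
    by_cases hext : x ∈ s.extremePoints ℝ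
    · exact subset_convexHull ℝ _ hext
    obtain ⟨D, hD, hD0⟩ : ∃ D ∈ hs.faceDirection hx, D ≠ 0 := by
      rw [mem_extremePoints] at hext
      push Not at hext
      obtain ⟨a, ha, b, hb, ⟨p, q, hp, hq, hpq, rfl⟩, hne⟩ := hext hx
      have hab : a ≠ b := by
        rintro rfl
        have : p • a + q • a = a := by rw [← add_smul, hpq, one_smul]
        exact hne this.symm this.symm
      refine ⟨a - b, ⟨min p q, lt_min hp hq, ?_, ?_⟩, sub_ne_zero.2 hab⟩
      · convert hs ha hb (a := p + min p q) (b := q - min p q) (by positivity)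
          (by linarith [min_le_right p q]) (by linarith) using 1
        module
      · convert hs ha hb (a := p - min p q) (b := q + min p q)
          (by linarith [min_le_left p q]) (by positivity) (by linarith) using 1
        module
    obtain ⟨t, ht, hy, hmax⟩ := hc.exists_max_ray hx hD0
    obtain ⟨u, hu, hz, hmax'⟩ := hc.exists_max_ray hx (neg_ne_zero.2 hD0)
    have h1 := ih _ (hk ▸ Submodule.finrank_lt_finrank_of_lt
      (hs.faceDirection_lt hx hD ht hy hmax)) _ hy rfl
    have h2 := ih _ (hk ▸ Submodule.finrank_lt_finrank_of_lt
      (hs.faceDirection_lt hx (neg_mem hD) hu hz hmax')) _ hz rfl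
    have htpos : 0 < t := by
      obtain ⟨ε, hε, h, -⟩ := hD
      exact hε.trans_le (hmax ε h)
    have hsum : t + u ≠ 0 := by positivity
    -- The point `x` lies between the two exits `x + t • D` and `x - u • D` of the line, each
    -- covered by induction.
    convert convex_convexHull ℝ (s.extremePoints ℝ) h1 h2 (a := u / (t + u)) (b := t / (t + u))
      (by positivity) (by positivity) (by field_simp; ring) using 1
    match_scalars <;> field_simp <;> ring

/-- In a finite-dimensional space the convex hull of a compact set is compact. -/
theorem IsCompact.convexHull_of_finiteDimensional {s : Set E} (hs : IsCompact s) :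
    IsCompact (convexHull ℝ s) := by
  -- By Carathéodory, `finrank + 1` points always suffice, so the hull is a continuous image of a
  -- compact product.
  have hK := (isCompact_stdSimplex ℝ (Fin (Module.finrank ℝ E + 1))).prod
    (isCompact_univ_pi fun _ : Fin (Module.finrank ℝ E + 1) => hs)
  have himg := hK.image_of_continuousOn (f := fun p => ∑ i, p.1 i • p.2 i)
    (Continuous.continuousOn (by fun_prop))
  convert himg using 1
  ext x
  constructor
  · intro hx
    rw [convexHull_eq_union] at hx
    simp only [Set.mem_iUnion] at hx
    obtain ⟨t, hts, hind, hxt⟩ := hx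
    have hcard : t.card ≤ Module.finrank ℝ E + 1 := by
      simpa using hind.card_le_finrank_succ.trans
        (Nat.succ_le_succ (Submodule.finrank_le _))
    have hne : Nonempty t := by
      by_contra h
      rw [not_nonempty_iff, Finset.isEmpty_coe_sort] at h
      simp [h] at hxt
    obtain ⟨e⟩ : Nonempty (t ↪ Fin (Module.finrank ℝ E + 1)) :=
      Function.Embedding.nonempty_of_card_le (by simpa using hcard)
    -- Unused indices get weight 0 and an arbitrary point of `t`, which is why `t` must be nonempty.
    set g := Function.invFun e with hg
    have hge : ∀ y, g (e y) = y := Function.leftInverse_invFun e.injective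
    rw [Finset.mem_convexHull] at hxt
    obtain ⟨w, hw0, hw1, rfl⟩ := hxt
    classical
    refine ⟨(fun i => if i ∈ Set.range e then w (g i) else 0, fun i => (g i : E)),
      ⟨⟨fun i => ?_, ?_⟩, fun i _ => hts (g i).2⟩, ?_⟩
    · dsimp only
      split_ifs
      exacts [hw0 _ (g i).2, le_rfl]
    · rw [← hw1, ← Finset.sum_coe_sort t w]
      symm
      refine Finset.sum_of_injOn e e.injective.injOn (by simp) ?_ ?_
      · intro i _ hi
        simp only [Set.mem_range]
        rw [if_neg]
        simpa using hi
      · intro y _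
        simp [hge]
    · rw [Finset.centerMass_eq_of_sum_1 _ _ hw1, ← Finset.sum_coe_sort t]
      symm
      refine Finset.sum_of_injOn e e.injective.injOn (by simp) ?_ ?_
      · intro i _ hi
        simp only [Set.mem_range]
        rw [if_neg, zero_smul]
        simpa using hi
      · intro y _
        simp [hge]
  · rintro ⟨⟨w, z⟩, ⟨hw, hz⟩, rfl⟩
    exact (convex_convexHull ℝ s).sum_mem (fun i _ => hw.1 i) hw.2
      fun i _ => subset_convexHull ℝ s (hz i trivial)

end FiniteDimensionalConvexity

namespace POVMRandomness

/-! ### Klein's inequality with a quadratic remainder -/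

section KleinInequality

/-- The middle term is `(√a - √b) ^ 2`: the left bound uses `√a + √b ≤ 2`, the right one `log x ≤ x
- 1` at `x = √b / √a`. -/
theorem quarter_sq_sub_le_klein {a b : ℝ} (ha0 : 0 ≤ a) (ha1 : a ≤ 1) (hb0 : 0 < b) (hb1 : b ≤ 1) :
    (a - b) ^ 2 / 4 ≤ a * (Real.log a - Real.log b) - a + b := by
  have hsq : (a - b) ^ 2 / 4 ≤ (√a - √b) ^ 2 := by
    have h1 : a - b = (√a - √b) * (√a + √b) := by
      have := Real.sq_sqrt ha0
      have := Real.sq_sqrt hb0.le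
      nlinarith
    have h2 : √a ≤ 1 := Real.sqrt_le_one.2 ha1
    have h3 : √b ≤ 1 := Real.sqrt_le_one.2 hb1
    have h4 : (√a + √b) ^ 2 ≤ 4 := by nlinarith [Real.sqrt_nonneg a, Real.sqrt_nonneg b]
    rw [h1, mul_pow]
    nlinarith [sq_nonneg (√a - √b)]
  refine hsq.trans ?_
  rcases ha0.eq_or_lt with rfl | ha
  · simp [Real.sq_sqrt hb0.le]
  have hsa : 0 < √a := Real.sqrt_pos.2 ha
  have hsb : 0 < √b := Real.sqrt_pos.2 hb0
  have hlog : Real.log a - Real.log b = -(2 * Real.log (√b / √a)) := by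
    rw [Real.log_div hsb.ne' hsa.ne', Real.log_sqrt ha.le, Real.log_sqrt hb0.le]
    ring
  have hle := Real.log_le_sub_one_of_pos (div_pos hsb hsa)
  have hmul : a * (√b / √a) = √a * √b := by
    rw [mul_div_assoc', div_eq_iff hsa.ne']
    nlinarith [Real.mul_self_sqrt ha.le]
  have : a * (2 * Real.log (√b / √a)) ≤ 2 * (√a * √b) - 2 * a := by nlinarith
  rw [hlog]
  nlinarith [Real.sq_sqrt ha.le, Real.sq_sqrt hb0.le]

variable {n : Type*} [Fintype n] [DecidableEq n]

theorem trace_diagonal_mul_mul_diagonal_mul_conjTranspose (W : Matrix n n ℂ) (x y : n → ℝ) :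
    (Matrix.diagonal (fun i => (x i : ℂ)) * W * Matrix.diagonal (fun i => (y i : ℂ)) * Wᴴ).trace =
      ((∑ i, ∑ j, Complex.normSq (W i j) * (x i * y j) : ℝ) : ℂ) := by
  simp only [Matrix.trace, Matrix.diag, Matrix.mul_apply (N := Wᴴ), Matrix.mul_diagonal,
    Matrix.diagonal_mul, Matrix.conjTranspose_apply]
  push_cast
  refine Finset.sum_congr rfl fun i _ => Finset.sum_congr rfl fun j _ => ?_
  rw [Complex.normSq_eq_conj_mul_self]
  simp only [Complex.star_def]
  ring

/-- The squared overlaps between the eigenbases of two Hermitian matrices. -/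
noncomputable def eigenOverlap {A B : Matrix n n ℂ} (hA : A.IsHermitian) (hB : B.IsHermitian) (i j : n) : ℝ :=
  Complex.normSq (((hA.eigenvectorUnitary : Matrix n n ℂ)ᴴ *
    (hB.eigenvectorUnitary : Matrix n n ℂ)) i j)

variable {A B : Matrix n n ℂ} (hA : A.IsHermitian) (hB : B.IsHermitian)

/-- The overlap weights are nonnegative and independent of `f` and `g`, so scalar inequalities
between eigenvalues become trace inequalities for noncommuting matrices. -/
theorem trace_cfc_mul_cfc (f g : ℝ → ℝ) :
    (cfc f A * cfc g B).trace =
      ((∑ i, ∑ j, eigenOverlap hA hB i j * (f (hA.eigenvalues i) * g (hB.eigenvalues j)) : ℝ) :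
        ℂ) := by
  unfold eigenOverlap
  rw [← trace_diagonal_mul_mul_diagonal_mul_conjTranspose, hA.cfc_eq, hB.cfc_eq,
    Matrix.IsHermitian.cfc, Matrix.IsHermitian.cfc, Unitary.conjStarAlgAut_apply,
    Unitary.conjStarAlgAut_apply]
  simp only [Matrix.conjTranspose_mul, Matrix.conjTranspose_conjTranspose,
    Matrix.star_eq_conjTranspose]
  simp only [Matrix.mul_assoc]
  rw [Matrix.trace_mul_comm]
  simp only [Matrix.mul_assoc]
  rfl

include hA in
theorem cfc_mul_of_isHermitian (f g : ℝ → ℝ) :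
    cfc f A * cfc g A = cfc (fun x => f x * g x) A := by
  rw [hA.cfc_eq, hA.cfc_eq, hA.cfc_eq, Matrix.IsHermitian.cfc, Matrix.IsHermitian.cfc,
    Matrix.IsHermitian.cfc, ← map_mul, Matrix.diagonal_mul_diagonal]
  simp [Function.comp_def]

/-- Klein's inequality with a quadratic remainder. -/
theorem quarter_trace_sq_sub_le_relEntropy {ρ σ : Matrix n n ℂ} (hρ : IsState ρ) (hσ : IsState σ)
    (hker : ∀ v, σ *ᵥ v = 0 → ρ *ᵥ v = 0) :
    ((ρ - σ) * (ρ - σ)).trace.re / 4 ≤ relEntropy ρ σ := by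
  obtain ⟨hρ0, hρ1⟩ := hρ
  obtain ⟨hσ0, hσ1⟩ := hσ
  have hρh := hρ0.isHermitian
  have hσh := hσ0.isHermitian
  have hle : ∀ {τ : Matrix n n ℂ} (h0 : τ.PosSemidef), τ.trace = 1 →
      ∀ i, h0.isHermitian.eigenvalues i ≤ 1 := by
    intro τ h0 h1 i
    rw [h0.isHermitian.trace_eq_sum_eigenvalues] at h1
    have h1' : ∑ i, h0.isHermitian.eigenvalues i = 1 := by
      simpa using congrArg Complex.re h1
    rw [← h1']
    exact Finset.single_le_sum (fun j _ => h0.eigenvalues_nonneg j) (Finset.mem_univ i)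
  set w := eigenOverlap hρh hσh with hw
  set a := hρh.eigenvalues with ha
  set b := hσh.eigenvalues with hb
  have hw0 : ∀ i j, 0 ≤ w i j := fun i j => Complex.normSq_nonneg _
  have hT : ∀ f g : ℝ → ℝ, (cfc f ρ * cfc g σ).trace.re = ∑ i, ∑ j, w i j * (f (a i) * g (b j)) := by
    intro f g
    rw [trace_cfc_mul_cfc hρh hσh, Complex.ofReal_re]
  have hidρ : cfc (fun x : ℝ => x) ρ = ρ := cfc_id' ℝ ρ hρh
  have hidσ : cfc (fun x : ℝ => x) σ = σ := cfc_id' ℝ σ hσh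
  have honeρ : cfc (fun _ : ℝ => 1) ρ = 1 := cfc_const_one ℝ ρ hρh
  have honeσ : cfc (fun _ : ℝ => 1) σ = 1 := cfc_const_one ℝ σ hσh
  have e1 := hT (fun x => x) (fun _ => 1)
  have e2 := hT (fun _ => 1) (fun x => x)
  have e3 := hT (fun x => x * x) (fun _ => 1)
  have e4 := hT (fun _ => 1) (fun x => x * x)
  have e5 := hT (fun x => x) (fun x => x)
  have e6 := hT (fun x => x * Real.logb 2 x) (fun _ => 1)
  have e7 := hT (fun x => x) (fun x => Real.logb 2 x)
  rw [← cfc_mul_of_isHermitian hρh] at e3 e6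
  rw [← cfc_mul_of_isHermitian hσh] at e4
  rw [hidρ, honeσ, mul_one] at e1 e3 e6
  rw [hidσ, honeρ, one_mul] at e2 e4
  rw [hidρ] at e5 e7
  rw [hidσ] at e5
  rw [hρ1, Complex.one_re] at e1
  rw [hσ1, Complex.one_re] at e2
  have hlhs : ((ρ - σ) * (ρ - σ)).trace.re =
      ∑ i, ∑ j, w i j * (a i - b j) ^ 2 := by
    have : (ρ - σ) * (ρ - σ) = ρ * ρ - ρ * σ - σ * ρ + σ * σ := by noncomm_ring
    rw [this, Matrix.trace_add, Matrix.trace_sub, Matrix.trace_sub, Matrix.trace_mul_comm σ ρ]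
    simp only [Complex.add_re, Complex.sub_re, e3, e4, e5, ← Finset.sum_add_distrib,
      ← Finset.sum_sub_distrib]
    exact Finset.sum_congr rfl fun i _ => Finset.sum_congr rfl fun j _ => by ring
  have hrel : relEntropy ρ σ * Real.log 2 =
      ∑ i, ∑ j, w i j * (a i * (Real.log (a i) - Real.log (b j)) - a i + b j) := by
    have h2 : Real.log 2 ≠ 0 := (Real.log_pos one_lt_two).ne'
    -- The extra terms `-a i + b j` cost nothing: they sum to `-1 + 1`, both traces being 1.
    have : relEntropy ρ σ * Real.log 2 =
        (∑ i, ∑ j, w i j * (a i * Real.logb 2 (a i) * 1) -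
          ∑ i, ∑ j, w i j * (a i * Real.logb 2 (b j))) * Real.log 2
        - ∑ i, ∑ j, w i j * (a i * 1) + ∑ i, ∑ j, w i j * (1 * b j) := by
      rw [← e1, ← e2, ← e6, ← e7]
      simp only [relEntropy, matrixLog, Matrix.trace_sub, Complex.sub_re]
      ring
    rw [this]
    simp only [Finset.sum_mul, ← Finset.sum_add_distrib, ← Finset.sum_sub_distrib]
    refine Finset.sum_congr rfl fun i _ => Finset.sum_congr rfl fun j _ => ?_
    simp only [Real.logb]
    field_simp
  -- The scalar inequality needs `b j > 0`. When `b j = 0`, the kernel condition makes `ρ` kill that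
  -- eigenvector of `σ`, so the `(i, j)` term drops out.
  have hsupp : ∀ i j, b j = 0 → w i j * a i = 0 := by
    intro i j hj
    set V : Matrix n n ℂ := (hσh.eigenvectorUnitary : Matrix n n ℂ) with hV
    set U : Matrix n n ℂ := (hρh.eigenvectorUnitary : Matrix n n ℂ) with hU
    have hzero : ρ *ᵥ (fun k => V k j) = 0 := by
      apply hker
      have := hσh.mulVec_eigenvectorBasis j
      rw [← hb, hj, zero_smul] at this
      exact this
    have hUU : Uᴴ * U = 1 := Unitary.coe_star_mul_self hρh.eigenvectorUnitary
    have hspec : Uᴴ * ρ = Matrix.diagonal (fun i => (a i : ℂ)) * Uᴴ := by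
      conv_lhs => rw [hρh.spectral_theorem, Unitary.conjStarAlgAut_apply]
      rw [← Matrix.mul_assoc, ← Matrix.mul_assoc, ← hU, hUU, one_mul]
      rfl
    have h0 : (Uᴴ * ρ * V) i j = 0 := by
      rw [Matrix.mul_assoc, Matrix.mul_apply_eq_vecMul]
      have : (ρ * V) = Matrix.of fun k l => (ρ *ᵥ fun m => V m l) k := by
        ext k l
        simp [Matrix.mul_apply, Matrix.mulVec, dotProduct]
      simp [this, Matrix.vecMul, dotProduct, hzero]
    rw [hspec, Matrix.mul_assoc, Matrix.diagonal_mul] at h0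
    rcases mul_eq_zero.1 h0 with h | h
    · rw [Complex.ofReal_eq_zero.1 h, mul_zero]
    · rw [hw, eigenOverlap, ← hU, ← hV, h, map_zero, zero_mul]
  have hmain : ((ρ - σ) * (ρ - σ)).trace.re / 4 ≤ relEntropy ρ σ * Real.log 2 := by
    rw [hlhs, hrel, Finset.sum_div]
    refine Finset.sum_le_sum fun i _ => ?_
    rw [Finset.sum_div]
    refine Finset.sum_le_sum fun j _ => ?_
    rcases (hσ0.eigenvalues_nonneg j).eq_or_lt with hj | hj
    · have hj' : b j = 0 := hj.symm
      have := hsupp i j hj'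
      rcases mul_eq_zero.1 this with h | h
      · simp [h]
      · simp [h, hj']
    · have := quarter_sq_sub_le_klein (hρ0.eigenvalues_nonneg i) (hle hρ0 hρ1 i) hj
        (hle hσ0 hσ1 j)
      rw [mul_div_assoc]
      exact mul_le_mul_of_nonneg_left this (hw0 i j)
  have hnonneg : 0 ≤ ((ρ - σ) * (ρ - σ)).trace.re := by
    rw [hlhs]
    exact Finset.sum_nonneg fun i _ => Finset.sum_nonneg fun j _ =>
      mul_nonneg (hw0 i j) (sq_nonneg _)
  -- Passing from natural to binary logarithms divides a nonnegative quantity by `log 2 ≤ 1`, which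
  -- preserves the bound.
  have hlog : Real.log 2 ≤ 1 := by linarith [Real.log_two_lt_d9]
  have hpos := Real.log_pos one_lt_two
  nlinarith

end KleinInequality

/-! ### The squared Frobenius norm and its convexity -/

section FrobeniusSquare

variable {n : Type*} [Fintype n]

/-- The squared Frobenius norm of a matrix. -/
noncomputable def frobSq (X : Matrix n n ℂ) : ℝ :=
  ∑ a, ∑ b, ‖X a b‖ ^ 2

theorem frobSq_nonneg (X : Matrix n n ℂ) : 0 ≤ frobSq X :=
  Finset.sum_nonneg fun _ _ => Finset.sum_nonneg fun _ _ => sq_nonneg _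

theorem frobSq_eq_zero_iff {X : Matrix n n ℂ} : frobSq X = 0 ↔ X = 0 := by
  constructor
  · intro h
    rw [frobSq, Finset.sum_eq_zero_iff_of_nonneg
      fun _ _ => Finset.sum_nonneg fun _ _ => sq_nonneg _] at h
    ext a b
    have := h a (Finset.mem_univ a)
    rw [Finset.sum_eq_zero_iff_of_nonneg fun _ _ => sq_nonneg _] at this
    simpa using this b (Finset.mem_univ b)
  · rintro rfl
    simp [frobSq]

theorem _root_.Matrix.IsHermitian.trace_mul_self_re {X : Matrix n n ℂ} (hX : X.IsHermitian) :
    (X * X).trace.re = frobSq X := by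
  conv_lhs => enter [1, 1, 2]; rw [← hX.eq]
  simp only [frobSq, Matrix.trace, Matrix.diag, Matrix.mul_apply, Matrix.conjTranspose_apply,
    Complex.re_sum]
  refine Finset.sum_congr rfl fun a _ => Finset.sum_congr rfl fun b _ => ?_
  rw [Complex.star_def, Complex.mul_conj, Complex.ofReal_re, Complex.normSq_eq_norm_sq]

theorem frobSq_sum_smul_le {κ : Type*} [Fintype κ] {q : κ → ℝ} (hq : ∀ j, 0 ≤ q j)
    (hq1 : ∑ j, q j = 1) (X : κ → Matrix n n ℂ) :
    frobSq (∑ j, q j • X j) ≤ ∑ j, q j * frobSq (X j) := by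
  have hrhs : ∑ j, q j * frobSq (X j) = ∑ a, ∑ b, ∑ j, q j * ‖X j a b‖ ^ 2 := by
    simp only [frobSq, Finset.mul_sum]
    rw [Finset.sum_comm]
    exact Finset.sum_congr rfl fun a _ => Finset.sum_comm
  rw [hrhs]
  refine Finset.sum_le_sum fun a _ => Finset.sum_le_sum fun b _ => ?_
  have h1 : ‖(∑ j, q j • X j) a b‖ ≤ ∑ j, q j • ‖X j a b‖ := by
    rw [Matrix.sum_apply]
    refine (norm_sum_le _ _).trans (Finset.sum_le_sum fun j _ => ?_)
    rw [Matrix.smul_apply, norm_smul, Real.norm_of_nonneg (hq j), smul_eq_mul]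
  have h2 := (convexOn_pow (𝕜 := ℝ) 2).map_sum_le (t := Finset.univ) (w := q)
    (p := fun j => ‖X j a b‖) (fun j _ => hq j) hq1 (fun j _ => norm_nonneg _)
  exact (pow_le_pow_left₀ (norm_nonneg _) h1 2).trans (by simpa using h2)

end FrobeniusSquare

/-! ### Dephasing and randomness for projection-valued measures -/

section ProjectionValuedMeasure

variable {n ι : Type*} [Fintype n] [DecidableEq n] [Fintype ι]

/-- A projection-valued measure: pairwise orthogonal orthogonal projections with sum `1`. -/
structure IsPVM (P : ι → Matrix n n ℂ) : Prop where
  isHermitian : ∀ i, (P i).IsHermitian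
  mul_self : ∀ i, P i * P i = P i
  mul_of_ne : ∀ i j, i ≠ j → P i * P j = 0
  sum_eq_one : ∑ i, P i = 1

variable {P : ι → Matrix n n ℂ} (hP : IsPVM P)

include hP

theorem IsPVM.posSemidef (i : ι) : (P i).PosSemidef := by
  rw [← hP.mul_self i]
  nth_rw 1 [← (hP.isHermitian i).eq]
  exact Matrix.posSemidef_conjTranspose_mul_self _

theorem IsPVM.isPOVM : IsPOVM P := ⟨hP.posSemidef, hP.sum_eq_one⟩

theorem IsPVM.mul_dephase (ρ : Matrix n n ℂ) (i : ι) : P i * dephase P ρ = P i * ρ * P i := by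
  rw [dephase, Finset.mul_sum, Finset.sum_eq_single i]
  · rw [← mul_assoc, ← mul_assoc, hP.mul_self]
  · intro j _ hj
    rw [← mul_assoc, ← mul_assoc, hP.mul_of_ne i j hj.symm, zero_mul, zero_mul]
  · simp

theorem IsPVM.dephase_mul (ρ : Matrix n n ℂ) (i : ι) : dephase P ρ * P i = P i * ρ * P i := by
  rw [dephase, Finset.sum_mul, Finset.sum_eq_single i]
  · rw [mul_assoc, hP.mul_self]
  · intro j _ hj
    rw [mul_assoc, hP.mul_of_ne j i hj, mul_zero]
  · simp

/-- Cyclicity merges the two copies of `P i` across `L`, and the `P i` sum to 1. The case `L = 1` is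
trace preservation; `L = matrixLog (dephase P ρ)` gives the entropy identity for pure states. -/
theorem IsPVM.trace_dephase_mul {ρ L : Matrix n n ℂ} (hL : ∀ i, Commute L (P i)) :
    (dephase P ρ * L).trace = (ρ * L).trace := by
  rw [dephase, Finset.sum_mul, Matrix.trace_sum]
  have : ∀ i, (P i * ρ * P i * L).trace = (ρ * L * P i).trace := by
    intro i
    rw [mul_assoc, ← (hL i).eq, mul_assoc, Matrix.trace_mul_comm, ← mul_assoc, mul_assoc,
      mul_assoc, hP.mul_self, mul_assoc]
  rw [Finset.sum_congr rfl fun i _ => this i, ← Matrix.trace_sum, ← Finset.mul_sum,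
    hP.sum_eq_one, mul_one]

theorem IsPVM.isState_dephase {ρ : Matrix n n ℂ} (hρ : IsState ρ) : IsState (dephase P ρ) := by
  refine ⟨Matrix.posSemidef_sum _ fun i _ => ?_, ?_⟩
  · have := hρ.1.mul_mul_conjTranspose_same (P i)
    rwa [(hP.isHermitian i).eq] at this
  · have := hP.trace_dephase_mul (ρ := ρ) (L := 1) fun i => Commute.one_left _
    rw [mul_one, mul_one] at this
    rw [this, hρ.2]

/-- Supplies the kernel condition of Klein's inequality: the dephased quadratic form at `v` is the
sum of the nonnegative forms of `ρ` at `P i *ᵥ v`. -/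
theorem IsPVM.mulVec_eq_zero_of_dephase_mulVec_eq_zero {ρ : Matrix n n ℂ} (hρ : ρ.PosSemidef)
    (v : n → ℂ) (hv : dephase P ρ *ᵥ v = 0) : ρ *ᵥ v = 0 := by
  have hz : ∀ i, ρ *ᵥ (P i *ᵥ v) = 0 := by
    intro i
    have h1 : star v ⬝ᵥ (dephase P ρ *ᵥ v) = ∑ i, star (P i *ᵥ v) ⬝ᵥ (ρ *ᵥ (P i *ᵥ v)) := by
      rw [dephase, Matrix.sum_mulVec, dotProduct_sum]
      refine Finset.sum_congr rfl fun j _ => ?_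
      rw [Matrix.star_mulVec, (hP.isHermitian j).eq, ← Matrix.dotProduct_mulVec,
        Matrix.mulVec_mulVec, Matrix.mulVec_mulVec]
    rw [hv, dotProduct_zero, eq_comm, Finset.sum_eq_zero_iff_of_nonneg
      fun j _ => hρ.dotProduct_mulVec_nonneg _] at h1
    exact (hρ.dotProduct_mulVec_zero_iff _).1 (h1 i (Finset.mem_univ i))
  calc ρ *ᵥ v = ρ *ᵥ ((∑ i, P i) *ᵥ v) := by rw [hP.sum_eq_one, Matrix.one_mulVec]
    _ = 0 := by
      rw [Matrix.sum_mulVec, Matrix.mulVec_sum]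
      exact Finset.sum_eq_zero fun i _ => hz i

/-- The quantum randomness bounds the squared Frobenius distance to the dephased state. -/
theorem IsPVM.frobSq_sub_dephase_le_Rq {ρ : Matrix n n ℂ} (hρ : IsState ρ) :
    frobSq (ρ - dephase P ρ) / 4 ≤ Rq ρ P := by
  have hσ := hP.isState_dephase hρ
  rw [← (hρ.1.isHermitian.sub hσ.1.isHermitian).trace_mul_self_re]
  exact quarter_trace_sq_sub_le_relEntropy hρ hσ
    (hP.mulVec_eq_zero_of_dephase_mulVec_eq_zero hρ.1)

omit hP

omit [DecidableEq n] in
theorem ketbra_mul_ketbra {ψ : n → ℂ} (hψ : star ψ ⬝ᵥ ψ = 1) :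
    ketbra ψ * ketbra ψ = ketbra ψ := by
  rw [ketbra, Matrix.vecMulVec_mul_vecMulVec, hψ, one_smul]

omit [DecidableEq n] in
theorem isState_ketbra {ψ : n → ℂ} (hψ : star ψ ⬝ᵥ ψ = 1) : IsState (ketbra ψ) := by
  refine ⟨Matrix.posSemidef_vecMulVec_self_star ψ, ?_⟩
  rw [ketbra, Matrix.trace_vecMulVec, dotProduct_comm, hψ]

theorem matrixLog_eq_zero_of_isIdempotentElem {Q : Matrix n n ℂ} (hQ : IsIdempotentElem Q) :
    matrixLog Q = 0 := by
  rw [matrixLog, cfc_congr (g := fun _ => (0 : ℝ)), cfc_const_zero]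
  intro x hx
  rcases hQ.spectrum_subset ℝ hx with rfl | rfl <;> simp

theorem entropy_ketbra {ψ : n → ℂ} (hψ : star ψ ⬝ᵥ ψ = 1) : entropy (ketbra ψ) = 0 := by
  simp [entropy, matrixLog_eq_zero_of_isIdempotentElem (ketbra_mul_ketbra hψ)]

include hP

/-- A pure state has zero matrix logarithm, and the logarithm of the dephased state commutes with
every `P i`. Bounds for `Rc` thus reduce to those for `Rq`. -/
theorem IsPVM.entropy_dephase_ketbra {ψ : n → ℂ} (hψ : star ψ ⬝ᵥ ψ = 1) :
    entropy (dephase P (ketbra ψ)) = Rq (ketbra ψ) P := by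
  have hcomm : ∀ i, Commute (matrixLog (dephase P (ketbra ψ))) (P i) := fun i =>
    Commute.cfc_real ((hP.dephase_mul _ i).trans (hP.mul_dephase _ i).symm) _
  rw [entropy, hP.trace_dephase_mul hcomm, Rq, relEntropy,
    matrixLog_eq_zero_of_isIdempotentElem (ketbra_mul_ketbra hψ), mul_zero, zero_sub,
    Matrix.trace_neg, Complex.neg_re]

theorem IsPVM.frobSq_sub_dephase_le_sum {ρ : Matrix n n ℂ} {l : ℕ} {q : Fin l → ℝ}
    {ψ : Fin l → n → ℂ} (h : IsPureDecomposition ρ q ψ) :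
    frobSq (ρ - dephase P ρ) / 4 ≤ ∑ j, q j * entropy (dephase P (ketbra (ψ j))) := by
  obtain ⟨hq0, hq1, hψ, rfl⟩ := h
  have hlin : ∑ j, q j • ketbra (ψ j) - dephase P (∑ j, q j • ketbra (ψ j)) =
      ∑ j, q j • (ketbra (ψ j) - dephase P (ketbra (ψ j))) := by
    simp only [smul_sub, Finset.sum_sub_distrib, dephase, Finset.mul_sum, Finset.sum_mul,
      Finset.smul_sum, mul_smul_comm, smul_mul_assoc]
    rw [Finset.sum_comm]
  rw [hlin]
  have h1 := frobSq_sum_smul_le hq0 hq1 fun j => ketbra (ψ j) - dephase P (ketbra (ψ j))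
  calc _ ≤ (∑ j, q j * frobSq (ketbra (ψ j) - dephase P (ketbra (ψ j)))) / 4 := by gcongr
    _ ≤ _ := by
      rw [Finset.sum_div]
      refine Finset.sum_le_sum fun j _ => ?_
      rw [hP.entropy_dephase_ketbra (hψ j), mul_div_assoc]
      exact mul_le_mul_of_nonneg_left (hP.frobSq_sub_dephase_le_Rq (isState_ketbra (hψ j)))
        (hq0 j)

omit hP

theorem _root_.Matrix.IsHermitian.eq_sum_eigenvalues_smul_ketbra {A : Matrix n n ℂ}
    (hA : A.IsHermitian) :
    A = ∑ i, hA.eigenvalues i • ketbra (hA.eigenvectorBasis i : n → ℂ) := by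
  conv_lhs => rw [hA.spectral_theorem, Unitary.conjStarAlgAut_apply]
  ext a b
  simp only [Matrix.mul_apply (N := star _), Matrix.mul_diagonal, Matrix.sum_apply,
    Matrix.smul_apply, ketbra, Matrix.vecMulVec_apply, Matrix.star_apply,
    Matrix.IsHermitian.eigenvectorUnitary_apply, Function.comp, Pi.star_apply]
  refine Finset.sum_congr rfl fun i _ => ?_
  rw [Complex.real_smul]
  simp only [RCLike.ofReal_eq_complex_ofReal]
  ring

theorem star_eigenvectorBasis_dotProduct {A : Matrix n n ℂ} (hA : A.IsHermitian) (i j : n) :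
    star (hA.eigenvectorBasis i : n → ℂ) ⬝ᵥ (hA.eigenvectorBasis j : n → ℂ) =
      if i = j then 1 else 0 := by
  have := orthonormal_iff_ite.1 hA.eigenvectorBasis.orthonormal i j
  rw [← this, EuclideanSpace.inner_eq_star_dotProduct, dotProduct_comm]

/-- Lower bounds on `Rc` need a nonempty set of values, since `sInf ∅ = 0`. -/
theorem IsState.exists_isPureDecomposition {ρ : Matrix n n ℂ} (hρ : IsState ρ) :
    ∃ (l : ℕ) (q : Fin l → ℝ) (ψ : Fin l → n → ℂ), IsPureDecomposition ρ q ψ := by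
  set h := hρ.1.isHermitian
  let e := (Fintype.equivFin n).symm
  refine ⟨Fintype.card n, fun k => h.eigenvalues (e k), fun k => h.eigenvectorBasis (e k),
    fun k => hρ.1.eigenvalues_nonneg _, ?_, fun k => ?_, ?_⟩
  · rw [e.sum_comp h.eigenvalues]
    simpa [h.trace_eq_sum_eigenvalues] using congrArg Complex.re hρ.2
  · rw [star_eigenvectorBasis_dotProduct, if_pos rfl]
  · rw [e.sum_comp fun i => h.eigenvalues i • ketbra (h.eigenvectorBasis i : n → ℂ)]
    exact h.eq_sum_eigenvalues_smul_ketbra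

include hP

theorem IsPVM.frobSq_sub_dephase_le_Rc {ρ : Matrix n n ℂ} (hρ : IsState ρ) :
    frobSq (ρ - dephase P ρ) / 4 ≤ Rc ρ P := by
  obtain ⟨l, q, ψ, h⟩ := hρ.exists_isPureDecomposition
  refine le_csInf ⟨_, l, q, ψ, h, rfl⟩ ?_
  rintro x ⟨l, q, ψ, h, rfl⟩
  exact hP.frobSq_sub_dephase_le_sum h

theorem IsPVM.dephase_ketbra_eq_self {ψ : n → ℂ} {i : ι} (hi : P i *ᵥ ψ = ψ) :
    dephase P (ketbra ψ) = ketbra ψ := by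
  have h0 : ∀ j, j ≠ i → P j *ᵥ ψ = 0 := by
    intro j hj
    rw [← hi, Matrix.mulVec_mulVec, hP.mul_of_ne j i hj, Matrix.zero_mulVec]
  have hk : ∀ j, P j * ketbra ψ * P j = ketbra (P j *ᵥ ψ) := by
    intro j
    rw [ketbra, ketbra, Matrix.mul_vecMulVec, Matrix.vecMulVec_mul, Matrix.star_mulVec,
      (hP.isHermitian j).eq]
  rw [dephase, Finset.sum_congr rfl fun j _ => hk j, Finset.sum_eq_single i, hi]
  · intro j _ hj
    rw [h0 j hj]
    simp [ketbra]
  · simp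

/-- Both randomness functions vanish on mixtures of vectors that the measurement leaves fixed. -/
theorem IsPVM.Rc_eq_zero {ρ : Matrix n n ℂ} {l : ℕ} {q : Fin l → ℝ}
    {ψ : Fin l → n → ℂ} (h : IsPureDecomposition ρ q ψ) (hfix : ∀ k, ∃ i, P i *ᵥ ψ k = ψ k) :
    Rc ρ P = 0 := by
  refine le_antisymm (csInf_le ⟨0, ?_⟩ ⟨l, q, ψ, h, ?_⟩) (Real.sInf_nonneg ?_)
  · rintro x ⟨l, q, ψ, h, rfl⟩
    exact (div_nonneg (frobSq_nonneg _) (by norm_num)).trans (hP.frobSq_sub_dephase_le_sum h)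
  · refine (Finset.sum_eq_zero fun k _ => ?_).symm
    obtain ⟨i, hi⟩ := hfix k
    rw [hP.dephase_ketbra_eq_self hi, entropy_ketbra (h.2.2.1 k), mul_zero]
  · rintro x ⟨l, q, ψ, h, rfl⟩
    exact (div_nonneg (frobSq_nonneg _) (by norm_num)).trans (hP.frobSq_sub_dephase_le_sum h)

theorem IsPVM.Rq_eq_zero {ρ : Matrix n n ℂ} {l : ℕ} {q : Fin l → ℝ}
    {ψ : Fin l → n → ℂ} (h : IsPureDecomposition ρ q ψ) (hfix : ∀ k, ∃ i, P i *ᵥ ψ k = ψ k) :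
    Rq ρ P = 0 := by
  have hdeph : dephase P ρ = ρ := by
    rw [h.2.2.2]
    calc dephase P (∑ j, q j • ketbra (ψ j)) = ∑ j, q j • dephase P (ketbra (ψ j)) := by
          simp only [dephase, Finset.mul_sum, Finset.sum_mul, Finset.smul_sum, mul_smul_comm,
            smul_mul_assoc]
          rw [Finset.sum_comm]
      _ = _ := by
          refine Finset.sum_congr rfl fun j _ => ?_
          obtain ⟨i, hi⟩ := hfix j
          rw [hP.dephase_ketbra_eq_self hi]
  rw [Rq, hdeph, relEntropy, sub_self, Matrix.trace_zero, Complex.zero_re]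

end ProjectionValuedMeasure

/-! ### Vanishing cross terms and `+1` eigenvectors -/

section CrossTerms

variable {n ι : Type*} [Fintype n] [DecidableEq n] [Fintype ι] {N : ι → Matrix n n ℂ}

/-- The outcome `i` already exhausts the total weight `star ψ ⬝ᵥ ψ`, so the other nonnegative
quadratic forms vanish at `ψ`. -/
theorem IsPOVM.mulVec_eq_zero_of_mulVec_eq_self (hN : IsPOVM N) {ψ : n → ℂ} {i j : ι}
    (hi : N i *ᵥ ψ = ψ) (hij : j ≠ i) : N j *ᵥ ψ = 0 := by
  classical
  have hsum : ∑ k ∈ Finset.univ.erase i, star ψ ⬝ᵥ (N k *ᵥ ψ) = 0 := by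
    have h1 : ∑ k, star ψ ⬝ᵥ (N k *ᵥ ψ) = star ψ ⬝ᵥ ψ := by
      rw [← dotProduct_sum, ← Matrix.sum_mulVec, hN.2, Matrix.one_mulVec]
    rw [← Finset.add_sum_erase _ _ (Finset.mem_univ i), hi] at h1
    simpa using h1
  rw [Finset.sum_eq_zero_iff_of_nonneg fun k _ => (hN.1 k).dotProduct_mulVec_nonneg _] at hsum
  exact ((hN.1 j).dotProduct_mulVec_zero_iff ψ).1 (hsum j (by simp [hij]))

theorem IsPOVM.mulVec_eq_self_of_forall_ne (hN : IsPOVM N) {ψ : n → ℂ} {i : ι}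
    (h : ∀ j, j ≠ i → N j *ᵥ ψ = 0) : N i *ᵥ ψ = ψ := by
  conv_rhs => rw [← Matrix.one_mulVec ψ, ← hN.2, Matrix.sum_mulVec]
  exact (Finset.sum_eq_single i (fun j _ hj => h j hj) (by simp)).symm

theorem IsPOVM.cross_eq_zero_of_mulVec_eq_self (hN : IsPOVM N) {ρ : Matrix n n ℂ} {s : ℕ}
    {q : Fin s → ℝ} {ψ : Fin s → n → ℂ} (hρ : ρ = ∑ k, q k • ketbra (ψ k))
    (hfix : ∀ k, ∃ i, N i *ᵥ ψ k = ψ k) {i i' : ι} (hne : i ≠ i') : N i * ρ * N i' = 0 := by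
  rw [hρ, Finset.mul_sum, Finset.sum_mul]
  refine Finset.sum_eq_zero fun k _ => ?_
  obtain ⟨j, hj⟩ := hfix k
  rw [mul_smul_comm, smul_mul_assoc, ketbra, Matrix.mul_vecMulVec, Matrix.vecMulVec_mul]
  by_cases hij : i = j
  · have h0 := hN.mulVec_eq_zero_of_mulVec_eq_self hj (hij ▸ hne.symm)
    have : star (ψ k) ᵥ* N i' = 0 := by
      have h := Matrix.star_mulVec (N i') (ψ k)
      rw [(hN.1 i').isHermitian.eq, h0, star_zero] at h
      exact h.symm
    rw [this, Matrix.vecMulVec_zero, smul_zero]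
  · rw [hN.mulVec_eq_zero_of_mulVec_eq_self hj hij, Matrix.zero_vecMulVec, smul_zero]

/-- Inserting `∑ N j = 1` gives `N i * ρ = N i * ρ * N i = ρ * N i`. Hence the `N i * ρ` are
positive, have zero products for distinct `i`, sum to `ρ` and are fixed by left multiplication by `N
i`. Diagonalizing each one separately gives the decomposition. -/
theorem IsPOVM.exists_isSpectralDecomposition_of_cross_eq_zero (hN : IsPOVM N)
    {ρ : Matrix n n ℂ} (hρ : ρ.PosSemidef) (hcross : ∀ i i', i ≠ i' → N i * ρ * N i' = 0) :
    ∃ (s : ℕ) (q : Fin s → ℝ) (ψ : Fin s → n → ℂ),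
      IsSpectralDecomposition ρ q ψ ∧ ∀ k, ∃ i, N i *ᵥ ψ k = ψ k := by
  classical
  have hleft : ∀ i, N i * ρ = N i * ρ * N i := by
    intro i
    conv_lhs => rw [← mul_one (N i * ρ), ← hN.2, Finset.mul_sum]
    exact Finset.sum_eq_single i (fun j _ hj => hcross i j hj.symm) (by simp)
  have hright : ∀ i, ρ * N i = N i * ρ * N i := by
    intro i
    conv_lhs => rw [← one_mul (ρ * N i), ← hN.2, Finset.sum_mul]
    simp_rw [← mul_assoc]
    exact Finset.sum_eq_single i (fun j _ hj => hcross j i hj) (by simp)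
  have hA : ∀ i, (N i * ρ).PosSemidef := by
    intro i
    rw [hleft]
    have := hρ.mul_mul_conjTranspose_same (N i)
    rwa [(hN.1 i).isHermitian.eq] at this
  have horth : ∀ i j, i ≠ j → N i * ρ * (N j * ρ) = 0 := by
    intro i j hij
    rw [← mul_assoc, hcross i j hij, zero_mul]
  have hfix : ∀ i, N i * (N i * ρ) = N i * ρ := by
    intro i
    conv_rhs => rw [hleft, mul_assoc, hright, ← hleft]
  let lam : (i : ι) → n → ℝ := fun i => (hA i).isHermitian.eigenvalues
  let v : (i : ι) → n → n → ℂ := fun i k => (hA i).isHermitian.eigenvectorBasis k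
  have heig : ∀ i k, (N i * ρ) *ᵥ v i k = (lam i k : ℂ) • v i k := by
    intro i k
    have := (hA i).isHermitian.mulVec_eigenvectorBasis k
    rw [this]
    ext a
    simp [lam, v]
  let κ := Σ i, {k : n // lam i k ≠ 0}
  let e : Fin (Fintype.card κ) ≃ κ := (Fintype.equivFin κ).symm
  have hortho : ∀ x y : κ, star (v x.1 x.2) ⬝ᵥ v y.1 y.2 = if x = y then 1 else 0 := by
    rintro ⟨i, k, hk⟩ ⟨j, k', hk'⟩
    by_cases hij : i = j
    · subst hij
      rw [star_eigenvectorBasis_dotProduct]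
      refine if_congr ⟨?_, ?_⟩ rfl rfl
      · rintro rfl
        rfl
      · intro h
        cases h
        rfl
    · rw [if_neg (by rintro ⟨⟩; exact hij rfl)]
      -- This inner product is that of the eigenvectors times two eigenvalues, which are nonzero by
      -- the choice of `κ`.
      have h0 : star ((N i * ρ) *ᵥ v i k) ⬝ᵥ ((N j * ρ) *ᵥ v j k') = 0 := by
        rw [Matrix.star_mulVec, (hA i).isHermitian.eq, ← Matrix.dotProduct_mulVec,
          Matrix.mulVec_mulVec, horth i j hij, Matrix.zero_mulVec, dotProduct_zero]
      rw [heig, heig, star_smul, smul_dotProduct, dotProduct_smul] at h0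
      simpa [hk, hk'] using h0
  refine ⟨Fintype.card κ, fun x => lam (e x).1 (e x).2, fun x => v (e x).1 (e x).2,
    ⟨fun x => ?_, fun x y => ?_, ?_⟩, fun x => ⟨(e x).1, ?_⟩⟩
  · exact ((hA (e x).1).eigenvalues_nonneg _).lt_of_ne' (e x).2.2
  · rw [hortho]
    simp
  · rw [e.sum_comp fun y : κ => lam y.1 y.2 • ketbra (v y.1 y.2), Fintype.sum_sigma]
    have h1 : ρ = ∑ i, N i * ρ := by rw [← Finset.sum_mul, hN.2, one_mul]
    conv_lhs => rw [h1]
    refine Finset.sum_congr rfl fun i _ => ?_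
    conv_lhs => rw [(hA i).isHermitian.eq_sum_eigenvalues_smul_ketbra]
    symm
    refine (Finset.sum_subtype (Finset.univ.filter fun k => lam i k ≠ 0) (by simp)
      fun k => lam i k • ketbra (v i k)).symm.trans (Finset.sum_filter_of_ne fun k _ hk => ?_)
    rintro h
    exact hk (by rw [h, zero_smul])
  · beta_reduce
    generalize e x = y
    obtain ⟨i, k, hk⟩ := y
    have h : N i *ᵥ ((N i * ρ) *ᵥ v i k) = (N i * ρ) *ᵥ v i k := by
      rw [Matrix.mulVec_mulVec, hfix]
    rw [heig, Matrix.mulVec_smul] at h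
    exact smul_right_injective (n → ℂ) (Complex.ofReal_ne_zero.2 hk) h

end CrossTerms

/-! ### Canonical Naimark extensions and the bound on cross terms -/

section NaimarkExtension

variable {n : Type*} [Fintype n] [DecidableEq n] {m : ℕ}

theorem isPVM_naimarkPVM {U : Matrix (n × Fin m) (n × Fin m) ℂ}
    (hU : U ∈ Matrix.unitaryGroup (n × Fin m) ℂ) : IsPVM (naimarkPVM U) := by
  have h1 : U * Uᴴ = 1 := Matrix.mem_unitaryGroup_iff.1 hU
  have h2 : Uᴴ * U = 1 := Matrix.mem_unitaryGroup_iff'.1 hU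
  have hmul : ∀ i j, naimarkPVM U i * naimarkPVM U j =
      Uᴴ * ((1 : Matrix n n ℂ) ⊗ₖ (Matrix.single i i (1 : ℂ) * Matrix.single j j 1)) * U := by
    intro i j
    simp only [naimarkPVM]
    calc _ = Uᴴ * ((1 : Matrix n n ℂ) ⊗ₖ Matrix.single i i (1 : ℂ)) * (U * Uᴴ) *
          ((1 : Matrix n n ℂ) ⊗ₖ Matrix.single j j (1 : ℂ)) * U := by simp only [mul_assoc]
      _ = _ := by
        rw [h1, mul_one, mul_assoc Uᴴ, ← Matrix.mul_kronecker_mul, mul_one]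
  refine ⟨fun i => ?_, fun i => ?_, fun i j hij => ?_, ?_⟩
  · simp [Matrix.IsHermitian, naimarkPVM, Matrix.conjTranspose_kronecker, mul_assoc]
  · rw [hmul, Matrix.single_mul_single_same, mul_one]
    rfl
  · rw [hmul, Matrix.single_mul_single_of_ne _ _ _ _ hij]
    simp
  · simp only [naimarkPVM]
    rw [← Finset.sum_mul, ← Finset.mul_sum]
    have : ∑ i, (1 : Matrix n n ℂ) ⊗ₖ Matrix.single i i (1 : ℂ) =
        (1 : Matrix (n × Fin m) (n × Fin m) ℂ) := by
      have hs : (1 : Matrix (Fin m) (Fin m) ℂ) = ∑ i, Matrix.single i i (1 : ℂ) := by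
        ext a b
        simp [Matrix.sum_apply, Matrix.single_apply, Matrix.one_apply, ite_and]
      rw [← Matrix.one_kronecker_one (m := n), hs]
      ext ⟨a, p⟩ ⟨b, q⟩
      simp [Matrix.sum_apply, Matrix.kroneckerMap_apply, Finset.mul_sum]
    rw [this, mul_one, h2]

open scoped MatrixOrder in
theorem _root_.Matrix.PosSemidef.exists_eq_conjTranspose_mul_self {A : Matrix n n ℂ}
    (hA : A.PosSemidef) : ∃ B : Matrix n n ℂ, A = Bᴴ * B :=
  CStarAlgebra.nonneg_iff_eq_star_mul_self.1 hA.nonneg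

/-- Diagonal entries are nonnegative and sum to 1 over the outcomes; a Gram factorization bounds
every other entry by the mean of two of them. -/
theorem IsPOVM.norm_apply_le_one {ι : Type*} [Fintype ι] {M : ι → Matrix n n ℂ} (hM : IsPOVM M)
    (i : ι) (a b : n) : ‖M i a b‖ ≤ 1 := by
  have hdiag : ∀ c, (M i c c).re ≤ 1 := by
    intro c
    have h1 : ∑ j, M j c c = 1 := by
      rw [← Matrix.sum_apply, hM.2, Matrix.one_apply_eq]
    have h2 : ∑ j, (M j c c).re = 1 := by rw [← Complex.re_sum, h1, Complex.one_re]
    rw [← h2]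
    exact Finset.single_le_sum (fun j _ => (Complex.le_def.1 (hM.1 j).diag_nonneg).1)
      (Finset.mem_univ i)
  obtain ⟨B, hB⟩ := (hM.1 i).exists_eq_conjTranspose_mul_self
  have hBd : ∀ c, (M i c c).re = ∑ k, ‖B k c‖ ^ 2 := by
    intro c
    rw [hB]
    simp only [Matrix.mul_apply, Matrix.conjTranspose_apply, Complex.re_sum]
    refine Finset.sum_congr rfl fun k _ => ?_
    rw [Complex.star_def, ← Complex.normSq_eq_conj_mul_self, Complex.ofReal_re,
      Complex.normSq_eq_norm_sq]
  calc ‖M i a b‖ ≤ ∑ k, ‖B k a‖ * ‖B k b‖ := by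
        rw [hB, Matrix.mul_apply]
        refine (norm_sum_le _ _).trans (Finset.sum_le_sum fun k _ => ?_)
        rw [norm_mul, Matrix.conjTranspose_apply, norm_star]
    _ ≤ ∑ k, (‖B k a‖ ^ 2 + ‖B k b‖ ^ 2) / 2 :=
        Finset.sum_le_sum fun k _ => by nlinarith [sq_nonneg (‖B k a‖ - ‖B k b‖)]
    _ = ((M i a a).re + (M i b b).re) / 2 := by
        rw [hBd, hBd, ← Finset.sum_div, Finset.sum_add_distrib]
    _ ≤ 1 := by linarith [hdiag a, hdiag b]

variable [NeZero m]

/-- The isometry `ψ ↦ ψ ⊗ |0⟩`. -/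
def ancillaIsometry (n : Type*) [DecidableEq n] (m : ℕ) [NeZero m] : Matrix (n × Fin m) n ℂ :=
  Matrix.of fun p b => if p = (b, 0) then 1 else 0

theorem conjTranspose_ancillaIsometry_mul_mul (X : Matrix (n × Fin m) (n × Fin m) ℂ) (a b : n) :
    ((ancillaIsometry n m)ᴴ * X * ancillaIsometry n m) a b = X (a, 0) (b, 0) := by
  simp [Matrix.mul_apply, ancillaIsometry, apply_ite star]

theorem conjTranspose_ancillaIsometry_mul_self :
    (ancillaIsometry n m)ᴴ * ancillaIsometry n m = 1 := by
  ext a b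
  have := conjTranspose_ancillaIsometry_mul_mul (n := n) (m := m) 1 a b
  rw [Matrix.mul_one] at this
  rw [this]
  simp [Matrix.one_apply]

theorem kronecker_ancilla (ρ : Matrix n n ℂ) :
    ρ ⊗ₖ ancilla m = ancillaIsometry n m * ρ * (ancillaIsometry n m)ᴴ := by
  ext ⟨a, p⟩ ⟨b, q⟩
  simp only [Matrix.kroneckerMap_apply, ancilla, Matrix.single_apply, Matrix.mul_apply,
    ancillaIsometry, Matrix.of_apply, Matrix.conjTranspose_apply, Prod.mk.injEq, ite_and]
  by_cases hp : p = 0 <;> by_cases hq : q = 0 <;>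
    simp [hp, hq, eq_comm, apply_ite star]

theorem isState_kronecker_ancilla {ρ : Matrix n n ℂ} (hρ : IsState ρ) :
    IsState (ρ ⊗ₖ ancilla m) := by
  rw [kronecker_ancilla]
  refine ⟨hρ.1.mul_mul_conjTranspose_same _, ?_⟩
  rw [Matrix.trace_mul_comm, ← Matrix.mul_assoc, conjTranspose_ancillaIsometry_mul_self,
    one_mul, hρ.2]

variable {N : Fin m → Matrix n n ℂ} {U : Matrix (n × Fin m) (n × Fin m) ℂ}

theorem partialTrace_mul_kronecker_ancilla (X : Matrix (n × Fin m) (n × Fin m) ℂ) :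
    partialTrace (X * ((1 : Matrix n n ℂ) ⊗ₖ ancilla m)) =
      (ancillaIsometry n m)ᴴ * X * ancillaIsometry n m := by
  ext a b
  rw [conjTranspose_ancillaIsometry_mul_mul]
  simp only [partialTrace, Matrix.of_apply, Matrix.mul_apply, Matrix.kroneckerMap_apply, ancilla,
    Matrix.single_apply, Fintype.sum_prod_type, Matrix.one_apply]
  simp [ite_and, Finset.sum_ite_eq]

theorem IsCanonicalExtension.eq_compression (h : IsCanonicalExtension N U) (i : Fin m) :
    N i = (ancillaIsometry n m)ᴴ * naimarkPVM U i * ancillaIsometry n m :=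
  (h.2 i).trans (partialTrace_mul_kronecker_ancilla _)

/-- Write `N i = (B i)ᴴ * B i`. The stacked columns of the `B i` are orthonormal because the `N i`
sum to 1; they become the columns `(a, 0)` of `U`, and any orthonormal completion gives the rest. -/
theorem IsPOVM.exists_isCanonicalExtension (hN : IsPOVM N) :
    ∃ U, IsCanonicalExtension N U := by
  choose B hB using fun i => (hN.1 i).exists_eq_conjTranspose_mul_self
  let v : n × Fin m → EuclideanSpace ℂ (n × Fin m) :=
    fun p => WithLp.toLp 2 fun x => B x.2 x.1 p.1
  have hinner : ∀ p q, inner ℂ (v p) (v q) = (1 : Matrix n n ℂ) p.1 q.1 := by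
    intro p q
    rw [← hN.2, Matrix.sum_apply, EuclideanSpace.inner_eq_star_dotProduct]
    simp only [v, dotProduct, Fintype.sum_prod_type, Pi.star_apply]
    rw [Finset.sum_comm]
    refine Finset.sum_congr rfl fun i _ => ?_
    conv_rhs => rw [hB, Matrix.mul_apply]
    exact Finset.sum_congr rfl fun k _ => mul_comm _ _
  have hv : Orthonormal ℂ (Set.domRestrict {p : n × Fin m | p.2 = 0} v) := by
    rw [orthonormal_iff_ite]
    rintro ⟨⟨a, p⟩, hp⟩ ⟨⟨b, q⟩, hq⟩
    simp only [Set.mem_ofPred_eq] at hp hq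
    subst hp hq
    simp [Set.domRestrict, hinner, Matrix.one_apply]
  obtain ⟨b, hb⟩ := hv.exists_orthonormalBasis_extension_of_card_eq (by simp)
  refine ⟨Matrix.of fun x p => b p x, ?_, fun i => ?_⟩
  · rw [Matrix.mem_unitaryGroup_iff']
    ext p q
    have := orthonormal_iff_ite.1 b.orthonormal p q
    rw [EuclideanSpace.inner_eq_star_dotProduct] at this
    rw [Matrix.one_apply, ← this, Matrix.mul_apply, dotProduct]
    exact Finset.sum_congr rfl fun k _ => mul_comm _ _
  · rw [partialTrace_mul_kronecker_ancilla]
    ext a c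
    rw [conjTranspose_ancillaIsometry_mul_mul, naimarkPVM, hB]
    have h0 : ∀ (a : n) (x : n × Fin m), b (a, 0) x = B x.2 x.1 a := by
      intro a x
      rw [hb (a, 0) rfl]
    simp only [Matrix.mul_apply, Matrix.kroneckerMap_apply, Matrix.conjTranspose_apply,
      Matrix.of_apply, Fintype.sum_prod_type, h0, Matrix.single_apply, Matrix.one_apply]
    simp [ite_and, Finset.sum_ite_eq]

/-- The sum of the squared Frobenius norms of the cross terms `N i ρ N i'`. -/
noncomputable def crossDefect {ι : Type*} [Fintype ι] [DecidableEq ι] (ρ : Matrix n n ℂ)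
    (N : ι → Matrix n n ℂ) : ℝ :=
  ∑ i, ∑ i', if i = i' then 0 else frobSq (N i * ρ * N i')

theorem norm_mul_mul_apply_sq_le {κ : Type*} [Fintype κ] {P Q X : Matrix κ κ ℂ}
    (hP : ∀ a b, ‖P a b‖ ≤ 1) (hQ : ∀ a b, ‖Q a b‖ ≤ 1) (a b : κ) :
    ‖(P * X * Q) a b‖ ^ 2 ≤ (Fintype.card κ : ℝ) ^ 2 * frobSq X := by
  have h1 : ‖(P * X * Q) a b‖ ≤ ∑ x : κ × κ, ‖X x.2 x.1‖ := by
    rw [Fintype.sum_prod_type, Matrix.mul_apply]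
    refine (norm_sum_le _ _).trans (Finset.sum_le_sum fun d _ => ?_)
    rw [norm_mul, Matrix.mul_apply]
    refine (mul_le_of_le_one_right (norm_nonneg _) (hQ d b)).trans ?_
    refine (norm_sum_le _ _).trans (Finset.sum_le_sum fun c _ => ?_)
    rw [norm_mul]
    exact mul_le_of_le_one_left (norm_nonneg _) (hP a c)
  refine (pow_le_pow_left₀ (norm_nonneg _) h1 2).trans (sq_sum_le_card_mul_sum_sq.trans_eq ?_)
  rw [Fintype.sum_prod_type, Finset.sum_comm, frobSq, Finset.card_univ, Fintype.card_prod]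
  push_cast
  ring

/-- The dephased state has no blocks between distinct projections, so subtracting it does not change
the block `(i, i')`, whose compression is `N i * ρ * N i'`. -/
theorem IsCanonicalExtension.frobSq_cross_le (h : IsCanonicalExtension N U) (ρ : Matrix n n ℂ)
    {i i' : Fin m} (hne : i ≠ i') :
    frobSq (N i * ρ * N i') ≤ (Fintype.card n : ℝ) ^ 2 * (Fintype.card (n × Fin m) : ℝ) ^ 2 *
      frobSq (ρ ⊗ₖ ancilla m - dephase (naimarkPVM U) (ρ ⊗ₖ ancilla m)) := by
  have hP := isPVM_naimarkPVM h.1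
  set E := ancillaIsometry n m with hE
  set X := ρ ⊗ₖ ancilla m - dephase (naimarkPVM U) (ρ ⊗ₖ ancilla m) with hX
  have hEq : N i * ρ * N i' = Eᴴ * (naimarkPVM U i * X * naimarkPVM U i') * E := by
    have hcancel : naimarkPVM U i * dephase (naimarkPVM U) (ρ ⊗ₖ ancilla m) * naimarkPVM U i' =
        0 := by
      rw [hP.mul_dephase, mul_assoc, hP.mul_of_ne i i' hne, mul_zero]
    rw [hX, mul_sub, sub_mul, hcancel, sub_zero, kronecker_ancilla, h.eq_compression i,
      h.eq_compression i']
    simp only [Matrix.mul_assoc, hE]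
  rw [hEq, frobSq]
  have hb := hP.isPOVM.norm_apply_le_one
  calc _ ≤ ∑ _a : n, ∑ _b : n, (Fintype.card (n × Fin m) : ℝ) ^ 2 * frobSq X := by
        refine Finset.sum_le_sum fun a _ => Finset.sum_le_sum fun b _ => ?_
        rw [conjTranspose_ancillaIsometry_mul_mul]
        exact norm_mul_mul_apply_sq_le (hb i) (hb i') _ _
    _ = _ := by
        simp only [Finset.sum_const, Finset.card_univ, nsmul_eq_mul]
        ring

variable {R : Matrix (n × Fin m) (n × Fin m) ℂ →
  (Fin m → Matrix (n × Fin m) (n × Fin m) ℂ) → ℝ} (hR : R = Rc ∨ R = Rq)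

include hR

theorem frobSq_sub_dephase_le {ρ : Matrix n n ℂ} (hρ : IsState ρ)
    (h : IsCanonicalExtension N U) :
    frobSq (ρ ⊗ₖ ancilla m - dephase (naimarkPVM U) (ρ ⊗ₖ ancilla m)) / 4 ≤
      R (ρ ⊗ₖ ancilla m) (naimarkPVM U) := by
  have hP := isPVM_naimarkPVM h.1
  rcases hR with rfl | rfl
  · exact hP.frobSq_sub_dephase_le_Rc (isState_kronecker_ancilla hρ)
  · exact hP.frobSq_sub_dephase_le_Rq (isState_kronecker_ancilla hρ)

theorem canonicalRandomness_nonneg {ρ : Matrix n n ℂ} (hρ : IsState ρ) :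
    0 ≤ canonicalRandomness R ρ N := by
  refine Real.sInf_nonneg ?_
  rintro x ⟨U, hU, rfl⟩
  exact (div_nonneg (frobSq_nonneg _) (by norm_num)).trans (frobSq_sub_dephase_le hR hρ hU)

theorem exists_crossDefect_le {ρ : Matrix n n ℂ} (hρ : IsState ρ) :
    ∃ K : ℝ, 0 < K ∧ ∀ N : Fin m → Matrix n n ℂ, IsPOVM N →
      crossDefect ρ N ≤ K * canonicalRandomness R ρ N := by
  set C : ℝ := (Fintype.card n : ℝ) ^ 2 * (Fintype.card (n × Fin m) : ℝ) ^ 2 with hC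
  have hC0 : 0 ≤ C := by positivity
  -- There are at most `m ^ 2` cross terms, each bounded by `C` times the Frobenius distance, which
  -- is at most `4 * R`; the `+ 1` only ensures positivity.
  refine ⟨4 * (m ^ 2 * C) + 1, by positivity, fun N hN => ?_⟩
  rw [← div_le_iff₀' (by positivity)]
  obtain ⟨U₀, hU₀⟩ := hN.exists_isCanonicalExtension
  refine le_csInf ⟨_, U₀, hU₀, rfl⟩ ?_
  rintro x ⟨U, hU, rfl⟩
  rw [div_le_iff₀' (by positivity)]
  have h1 := frobSq_sub_dephase_le hR hρ hU
  set f := frobSq (ρ ⊗ₖ ancilla m - dephase (naimarkPVM U) (ρ ⊗ₖ ancilla m))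
  have hf : 0 ≤ f := frobSq_nonneg _
  have h2 : crossDefect ρ N ≤ ∑ _i : Fin m, ∑ _i' : Fin m, C * f := by
    refine Finset.sum_le_sum fun i _ => Finset.sum_le_sum fun i' _ => ?_
    split_ifs with hne
    · positivity
    · exact hU.frobSq_cross_le ρ hne
  simp only [Finset.sum_const, Finset.card_univ, nsmul_eq_mul, Fintype.card_fin] at h2
  have h3 : m ^ 2 * C * f ≤ 4 * (m ^ 2 * C) * R (ρ ⊗ₖ ancilla m) (naimarkPVM U) := by
    have : 0 ≤ (m : ℝ) ^ 2 * C := by positivity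
    nlinarith
  have h4 : 0 ≤ R (ρ ⊗ₖ ancilla m) (naimarkPVM U) := (by positivity : 0 ≤ f / 4).trans h1
  nlinarith

theorem IsPOVM.canonicalRandomness_eq_zero (hN : IsPOVM N) {ρ : Matrix n n ℂ} (hρ : IsState ρ)
    {s : ℕ} {q : Fin s → ℝ} {ψ : Fin s → n → ℂ} (hdec : IsSpectralDecomposition ρ q ψ)
    (hfix : ∀ k, ∃ i, N i *ᵥ ψ k = ψ k) : canonicalRandomness R ρ N = 0 := by
  set E := ancillaIsometry n m with hE
  have hEE : Eᴴ * E = 1 := conjTranspose_ancillaIsometry_mul_self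
  have hunit : ∀ k, star (ψ k) ⬝ᵥ ψ k = 1 := fun k => by rw [hdec.2.1, if_pos rfl]
  have hpure : IsPureDecomposition (ρ ⊗ₖ ancilla m) q fun k => E *ᵥ ψ k := by
    refine ⟨fun k => (hdec.1 k).le, ?_, fun k => ?_, ?_⟩
    · have h := hρ.2
      rw [hdec.2.2, Matrix.trace_sum] at h
      simp only [Matrix.trace_smul, (isState_ketbra (hunit _)).2] at h
      simpa using congrArg Complex.re h
    · rw [Matrix.star_mulVec, ← Matrix.dotProduct_mulVec, Matrix.mulVec_mulVec, hEE,
        Matrix.one_mulVec, hunit]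
    · rw [kronecker_ancilla, ← hE]
      conv_lhs => rw [hdec.2.2]
      rw [Matrix.mul_sum, Matrix.sum_mul]
      refine Finset.sum_congr rfl fun k _ => ?_
      rw [Matrix.mul_smul, Matrix.smul_mul, ketbra, ketbra, Matrix.mul_vecMulVec,
        Matrix.vecMulVec_mul, Matrix.star_mulVec]
  have hzero : ∀ U, IsCanonicalExtension N U → R (ρ ⊗ₖ ancilla m) (naimarkPVM U) = 0 := by
    intro U hU
    have hP := isPVM_naimarkPVM hU.1
    have hfixE : ∀ k, ∃ i, naimarkPVM U i *ᵥ (E *ᵥ ψ k) = E *ᵥ ψ k := by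
      intro k
      obtain ⟨i, hi⟩ := hfix k
      -- The quadratic form of the dilated projection at `E *ᵥ ψ k` is that of `N j` at `ψ k`, which
      -- vanishes.
      have h0 : ∀ j, j ≠ i → naimarkPVM U j *ᵥ (E *ᵥ ψ k) = 0 := by
        intro j hj
        rw [← (hP.posSemidef j).dotProduct_mulVec_zero_iff, Matrix.star_mulVec,
          ← Matrix.dotProduct_mulVec, Matrix.mulVec_mulVec, Matrix.mulVec_mulVec,
          ← hU.eq_compression,
          hN.mulVec_eq_zero_of_mulVec_eq_self hi hj, dotProduct_zero]
      exact ⟨i, hP.isPOVM.mulVec_eq_self_of_forall_ne h0⟩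
    rcases hR with rfl | rfl
    · exact hP.Rc_eq_zero hpure hfixE
    · exact hP.Rq_eq_zero hpure hfixE
  obtain ⟨U₀, hU₀⟩ := hN.exists_isCanonicalExtension
  refine le_antisymm (csInf_le ⟨0, ?_⟩ ⟨U₀, hU₀, (hzero U₀ hU₀).symm⟩)
    (canonicalRandomness_nonneg hR hρ)
  rintro x ⟨U, hU, rfl⟩
  rw [hzero U hU]

end NaimarkExtension

/-! ### Compactness, cross-free POVMs and separation -/

section CompactnessOfPOVMs

variable {n ι : Type*} [Fintype n] [DecidableEq n] [Fintype ι]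

theorem convex_setOf_isPOVM : Convex ℝ {M : ι → Matrix n n ℂ | IsPOVM M} := by
  intro M hM N hN a b ha hb hab
  refine ⟨fun i => ?_, ?_⟩
  · exact ((hM.1 i).smul ha).add ((hN.1 i).smul hb)
  · simp only [Pi.add_apply, Pi.smul_apply]
    rw [Finset.sum_add_distrib, ← Finset.smul_sum, ← Finset.smul_sum, hM.2, hN.2, ← add_smul,
      hab, one_smul]

omit [DecidableEq n] in
theorem isClosed_setOf_posSemidef : IsClosed {A : Matrix n n ℂ | A.PosSemidef} := by
  simp only [Matrix.posSemidef_iff_dotProduct_mulVec, Matrix.IsHermitian, Set.ofPred_and,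
    Set.ofPred_forall, Complex.le_def]
  refine IsClosed.inter (isClosed_eq (by fun_prop) continuous_id) (isClosed_iInter fun x => ?_)
  exact IsClosed.inter (isClosed_le (by fun_prop) (by fun_prop))
    (isClosed_eq (by fun_prop) (by fun_prop))

theorem isCompact_setOf_isPOVM : IsCompact {M : ι → Matrix n n ℂ | IsPOVM M} := by
  have hbig : IsCompact (Set.univ.pi fun _ : ι => Set.univ.pi fun _ : n => Set.univ.pi
      fun _ : n => Metric.closedBall (0 : ℂ) 1) :=
    isCompact_univ_pi fun _ => isCompact_univ_pi fun _ => isCompact_univ_pi fun _ =>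
      isCompact_closedBall _ _
  refine IsCompact.of_isClosed_subset (X := ι → n → n → ℂ) hbig ?_ ?_
  · have : IsClosed {M : ι → Matrix n n ℂ | IsPOVM M} := by
      simp only [IsPOVM, Set.ofPred_and, Set.ofPred_forall]
      refine IsClosed.inter (isClosed_iInter fun i => ?_)
        (isClosed_eq (by fun_prop) continuous_const)
      exact isClosed_setOf_posSemidef.preimage
        (f := fun M : ι → Matrix n n ℂ => M i) (continuous_apply i)
    exact this
  · intro M hM i _ a _ b _
    simpa using IsPOVM.norm_apply_le_one hM i a b

variable [DecidableEq ι]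

omit [DecidableEq n] in
theorem continuous_crossDefect (ρ : Matrix n n ℂ) :
    Continuous fun N : ι → Matrix n n ℂ => crossDefect ρ N := by
  unfold crossDefect
  refine continuous_finsetSum _ fun i _ => continuous_finsetSum _ fun i' _ => ?_
  split_ifs
  · exact continuous_const
  · unfold frobSq
    refine continuous_finsetSum _ fun a _ => continuous_finsetSum _ fun b _ => ?_
    have : Continuous fun N : ι → Matrix n n ℂ => N i * ρ * N i' := by fun_prop
    exact ((this.matrix_elem a b).norm).pow 2

omit [DecidableEq n] in
theorem crossDefect_nonneg (ρ : Matrix n n ℂ) (N : ι → Matrix n n ℂ) : 0 ≤ crossDefect ρ N :=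
  Finset.sum_nonneg fun i _ => Finset.sum_nonneg fun i' _ => by
    split_ifs
    exacts [le_rfl, frobSq_nonneg _]

omit [DecidableEq n] in
theorem crossDefect_eq_zero_iff {ρ : Matrix n n ℂ} {N : ι → Matrix n n ℂ} :
    crossDefect ρ N = 0 ↔ ∀ i i', i ≠ i' → N i * ρ * N i' = 0 := by
  have hterm : ∀ i i', 0 ≤ if i = i' then 0 else frobSq (N i * ρ * N i') := by
    intro i i'
    split_ifs
    exacts [le_rfl, frobSq_nonneg _]
  rw [crossDefect, Finset.sum_eq_zero_iff_of_nonneg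
    fun i _ => Finset.sum_nonneg fun i' _ => hterm i i']
  simp only [Finset.sum_eq_zero_iff_of_nonneg fun i' _ => hterm _ i', Finset.mem_univ,
    true_imp_iff, ite_eq_left_iff, frobSq_eq_zero_iff]

/-- POVMs whose cross terms with `ρ` vanish. -/
def crossFree (ι : Type*) [Fintype ι] [DecidableEq ι] (ρ : Matrix n n ℂ) :
    Set (ι → Matrix n n ℂ) :=
  {N | IsPOVM N ∧ crossDefect ρ N = 0}

theorem isCompact_crossFree (ρ : Matrix n n ℂ) : IsCompact (crossFree ι ρ) :=
  isCompact_setOf_isPOVM.inter_right (isClosed_eq (continuous_crossDefect ρ) continuous_const)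

/-- Vanishing of the cross terms passes to the components of a convex combination. -/
theorem mem_crossFree_of_sum_smul_mem {κ : Type*} [Fintype κ] {ρ : Matrix n n ℂ}
    (hρ : ρ.PosSemidef) {w : κ → ℝ} (hw : ∀ j, 0 < w j) {F : κ → ι → Matrix n n ℂ}
    (hF : ∀ j, IsPOVM (F j)) (hsum : ∑ j, w j • F j ∈ crossFree ι ρ) (j : κ) :
    F j ∈ crossFree ι ρ := by
  obtain ⟨hN, hcross⟩ := hsum
  rw [crossDefect_eq_zero_iff] at hcross
  -- One spectral decomposition serves all components: at each `ψ k` the zero quadratic forms of the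
  -- mixture are positive combinations of nonnegative ones, so they vanish componentwise.
  obtain ⟨s, q, ψ, hdec, hfix⟩ := hN.exists_isSpectralDecomposition_of_cross_eq_zero hρ hcross
  refine ⟨hF j, crossDefect_eq_zero_iff.2 fun i i' hne =>
    (hF j).cross_eq_zero_of_mulVec_eq_self hdec.2.2 (fun k => ?_) hne⟩
  obtain ⟨i, hi⟩ := hfix k
  refine ⟨i, (hF j).mulVec_eq_self_of_forall_ne fun i' hi' => ?_⟩
  have h0 := hN.mulVec_eq_zero_of_mulVec_eq_self hi hi'
  have h1 : ∑ j, w j • (star (ψ k) ⬝ᵥ (F j i' *ᵥ ψ k)) = 0 := by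
    have : star (ψ k) ⬝ᵥ ((∑ j, w j • F j) i' *ᵥ ψ k) = 0 := by rw [h0, dotProduct_zero]
    rw [← this, Finset.sum_apply, Matrix.sum_mulVec, dotProduct_sum]
    refine Finset.sum_congr rfl fun j _ => ?_
    rw [Pi.smul_apply, Matrix.smul_mulVec, dotProduct_smul]
  rw [Finset.sum_eq_zero_iff_of_nonneg fun j _ =>
    smul_nonneg (hw j).le (((hF j).1 i').dotProduct_mulVec_nonneg _)] at h1
  exact (((hF j).1 i').dotProduct_mulVec_zero_iff _).1
    ((smul_eq_zero.1 (h1 j (Finset.mem_univ j))).resolve_left (hw j).ne')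

omit [DecidableEq ι] in
theorem IsExtremalPOVM.isPOVM {N : ι → Matrix n n ℂ} (h : IsExtremalPOVM N) : IsPOVM N :=
  h.1

omit [DecidableEq ι] in
theorem exists_isExtremalDecomposition_of_mem_convexHull {M : ι → Matrix n n ℂ}
    {S : Set (ι → Matrix n n ℂ)} (hS : ∀ N ∈ S, IsExtremalPOVM N) (hM : M ∈ convexHull ℝ S) :
    ∃ (l : ℕ) (r : Fin l → ℝ) (N : Fin l → ι → Matrix n n ℂ),
      IsExtremalDecomposition M r N ∧ ∀ j, N j ∈ S := by
  obtain ⟨κ, _, z, w, hz, -, hw, hw1, hsum⟩ := eq_pos_convex_span_of_mem_convexHull hM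
  let e := (Fintype.equivFin κ).symm
  have hmem : ∀ j, z j ∈ S := fun j => hz ⟨j, rfl⟩
  refine ⟨Fintype.card κ, w ∘ e, z ∘ e, ⟨fun j => hw _, ?_, fun j => hS _ (hmem _), fun i => ?_⟩,
    fun j => hmem _⟩
  · rw [← hw1]
    exact e.sum_comp w
  · rw [← hsum, Finset.sum_apply]
    exact (e.sum_comp fun j => w j • z j i).symm

omit [DecidableEq ι] in
theorem IsPOVM.exists_isExtremalDecomposition {M : ι → Matrix n n ℂ} (hM : IsPOVM M) :
    ∃ (l : ℕ) (r : Fin l → ℝ) (N : Fin l → ι → Matrix n n ℂ), IsExtremalDecomposition M r N := by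
  obtain ⟨l, r, N, h, -⟩ := exists_isExtremalDecomposition_of_mem_convexHull (fun _ h => h)
    (isCompact_setOf_isPOVM.subset_convexHull_extremePoints convex_setOf_isPOVM hM)
  exact ⟨l, r, N, h⟩

/-- An extremal decomposition of a cross-free POVM has only cross-free components, so the extremal
cross-free POVMs already span the hull. -/
theorem exists_isExtremalDecomposition_crossFree {ρ : Matrix n n ℂ} (hρ : ρ.PosSemidef)
    {M : ι → Matrix n n ℂ} (hM : M ∈ convexHull ℝ (crossFree ι ρ)) :
    ∃ (l : ℕ) (r : Fin l → ℝ) (N : Fin l → ι → Matrix n n ℂ),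
      IsExtremalDecomposition M r N ∧ CrossTermsVanish ρ N := by
  have hsub : crossFree ι ρ ⊆
      convexHull ℝ (crossFree ι ρ ∩ {N | IsExtremalPOVM N}) := by
    intro N hN
    obtain ⟨κ, _, z, w, hz, -, hw, hw1, hsum⟩ := eq_pos_convex_span_of_mem_convexHull
      (isCompact_setOf_isPOVM.subset_convexHull_extremePoints convex_setOf_isPOVM hN.1)
    have hext : ∀ j, IsExtremalPOVM (z j) := fun j => hz ⟨j, rfl⟩
    have hmem := mem_crossFree_of_sum_smul_mem hρ hw (fun j => (hext j).isPOVM) (hsum ▸ hN)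
    rw [← hsum]
    exact (convex_convexHull ℝ _).sum_mem (fun j _ => (hw j).le) hw1
      fun j _ => subset_convexHull ℝ _ ⟨hmem j, hext j⟩
  obtain ⟨l, r, N, h, hN⟩ := exists_isExtremalDecomposition_of_mem_convexHull
    (fun N hN => hN.2) (convexHull_min hsub (convex_convexHull ℝ _) hM)
  exact ⟨l, r, N, h, fun j => crossDefect_eq_zero_iff.1 (hN j).1.2⟩

/-- A POVM outside the convex hull of the cross-free POVMs has positive average defect, uniformly
over its decompositions. -/
theorem exists_pos_le_sum_crossDefect {ρ : Matrix n n ℂ} {M : ι → Matrix n n ℂ} (hM : IsPOVM M)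
    (hnot : M ∉ convexHull ℝ (crossFree ι ρ)) :
    ∃ c : ℝ, 0 < c ∧ ∀ (l : ℕ) (r : Fin l → ℝ) (N : Fin l → ι → Matrix n n ℂ),
      IsExtremalDecomposition M r N → c ≤ ∑ j, r j * crossDefect ρ (N j) := by
  have : LocallyConvexSpace ℝ (Matrix n n ℂ) :=
    inferInstanceAs (LocallyConvexSpace ℝ (n → n → ℂ))
  obtain ⟨f, u, hfu, huM⟩ := geometric_hahn_banach_closed_point (convex_convexHull ℝ _)
    (isCompact_crossFree ρ).convexHull_of_finiteDimensional.isClosed hnot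
  set C := {M : ι → Matrix n n ℂ | IsPOVM M} with hC
  have hCc : IsCompact C := isCompact_setOf_isPOVM
  obtain ⟨N₁, hN₁, hmax⟩ := hCc.exists_isMaxOn ⟨M, hM⟩ f.continuous.continuousOn
  -- The POVMs with `u ≤ f` form a compact set containing no cross-free one, so the defect has a
  -- positive minimum there.
  obtain ⟨N₀, hN₀, hmin⟩ := (hCc.inter_right (isClosed_le (continuous_const (y := u))
    f.continuous)).exists_isMinOn ⟨M, hM, huM.le⟩ (continuous_crossDefect ρ).continuousOn
  set ε := crossDefect ρ N₀ with hε
  have hεpos : 0 < ε := by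
    refine (crossDefect_nonneg ρ N₀).lt_of_ne' fun h0 => ?_
    exact absurd (hfu N₀ (subset_convexHull ℝ _ ⟨hN₀.1, h0⟩)) (not_lt.2 hN₀.2)
  have hBu : 0 < f N₁ - u := sub_pos.2 (huM.trans_le (hmax hM))
  -- The left side is affine in `N`, so its average over any decomposition of `M` is `f M - u > 0`.
  have hkey : ∀ N, IsPOVM N → f N - u ≤ (f N₁ - u) / ε * crossDefect ρ N := by
    intro N hN
    rcases lt_or_ge (f N) u with h | h
    · exact (sub_neg.2 h).le.trans
        (mul_nonneg (div_pos hBu hεpos).le (crossDefect_nonneg ρ N))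
    · have h1 : f N ≤ f N₁ := hmax hN
      have h2 : ε ≤ crossDefect ρ N := hmin ⟨hN, h⟩
      calc f N - u ≤ (f N₁ - u) / ε * ε := by
            rw [div_mul_cancel₀ _ hεpos.ne']
            linarith
        _ ≤ _ := mul_le_mul_of_nonneg_left h2 (div_pos hBu hεpos).le
  refine ⟨(f M - u) / ((f N₁ - u) / ε), div_pos (sub_pos.2 huM) (div_pos hBu hεpos), ?_⟩
  rintro l r N ⟨hr, hr1, hN, hMN⟩
  rw [div_le_iff₀' (div_pos hBu hεpos)]
  have hfM : f M - u = ∑ j, r j * (f (N j) - u) := by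
    have : M = ∑ j, r j • N j := by
      ext1 i
      rw [hMN, Finset.sum_apply]
      rfl
    rw [this, map_sum]
    simp only [map_smul, smul_eq_mul, mul_sub, Finset.sum_sub_distrib, ← Finset.sum_mul, hr1,
      one_mul]
  rw [hfM, Finset.mul_sum]
  refine Finset.sum_le_sum fun j _ => ?_
  calc r j * (f (N j) - u) ≤ r j * ((f N₁ - u) / ε * crossDefect ρ (N j)) :=
        mul_le_mul_of_nonneg_left (hkey _ (hN j).isPOVM) (hr j).le
    _ = _ := by ring

end CompactnessOfPOVMs

/-! ### The characterization of zero randomness -/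

section Characterization

variable {n : Type*} [Fintype n] [DecidableEq n] {m : ℕ} [NeZero m]
  {R : Matrix (n × Fin m) (n × Fin m) ℂ →
    (Fin m → Matrix (n × Fin m) (n × Fin m) ℂ) → ℝ} (hR : R = Rc ∨ R = Rq)
  {ρ : Matrix n n ℂ} (hρ : IsState ρ) {M : Fin m → Matrix n n ℂ}

include hρ

omit [NeZero m] in
theorem crossTermsVanish_iff_spectralPlusOne {l : ℕ} {r : Fin l → ℝ}
    {N : Fin l → Fin m → Matrix n n ℂ} (h : IsExtremalDecomposition M r N) :
    CrossTermsVanish ρ N ↔ SpectralPlusOne ρ N := by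
  refine ⟨fun hc j => ?_, fun hs j i i' hne => ?_⟩
  · exact (h.2.2.1 j).isPOVM.exists_isSpectralDecomposition_of_cross_eq_zero hρ.1 (hc j)
  · obtain ⟨s, q, ψ, hdec, hfix⟩ := hs j
    exact (h.2.2.1 j).isPOVM.cross_eq_zero_of_mulVec_eq_self hdec.2.2 hfix hne

include hR

theorem Rcf_eq_zero_iff_crossTermsVanish (hM : IsPOVM M) :
    Rcf R ρ M = 0 ↔ ∃ (l : ℕ) (r : Fin l → ℝ) (N : Fin l → Fin m → Matrix n n ℂ),
      IsExtremalDecomposition M r N ∧ CrossTermsVanish ρ N := by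
  have hnonneg : ∀ {l : ℕ} {r : Fin l → ℝ} {N : Fin l → Fin m → Matrix n n ℂ},
      IsExtremalDecomposition M r N → 0 ≤ ∑ j, r j * canonicalRandomness R ρ (N j) :=
    fun h => Finset.sum_nonneg fun j _ =>
      mul_nonneg (h.1 j).le (canonicalRandomness_nonneg hR hρ)
  constructor
  · intro h0
    by_contra hno
    have hnot : M ∉ convexHull ℝ (crossFree (Fin m) ρ) := fun hmem =>
      hno (exists_isExtremalDecomposition_crossFree hρ.1 hmem)
    obtain ⟨c, hc, hlow⟩ := exists_pos_le_sum_crossDefect hM hnot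
    obtain ⟨K, hK, hKle⟩ := exists_crossDefect_le (m := m) hR hρ
    have hle : c / K ≤ Rcf R ρ M := by
      -- Minkowski's theorem rules out the default value `sInf ∅ = 0`.
      obtain ⟨l₀, r₀, N₀, h₀⟩ := hM.exists_isExtremalDecomposition
      refine le_csInf ⟨_, l₀, r₀, N₀, h₀, rfl⟩ ?_
      rintro x ⟨l, r, N, h, rfl⟩
      rw [div_le_iff₀' hK, Finset.mul_sum]
      refine (hlow l r N h).trans (Finset.sum_le_sum fun j _ => ?_)
      calc r j * crossDefect ρ (N j) ≤ r j * (K * canonicalRandomness R ρ (N j)) :=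
            mul_le_mul_of_nonneg_left (hKle _ (h.2.2.1 j).isPOVM) (h.1 j).le
        _ = _ := by ring
    exact absurd (h0 ▸ hle) (not_le.2 (div_pos hc hK))
  · rintro ⟨l, r, N, h, hcross⟩
    refine le_antisymm (csInf_le ⟨0, ?_⟩ ⟨l, r, N, h, ?_⟩) (Real.sInf_nonneg ?_)
    · rintro x ⟨l, r, N, h, rfl⟩
      exact hnonneg h
    · refine (Finset.sum_eq_zero fun j _ => ?_).symm
      obtain ⟨s, q, ψ, hdec, hfix⟩ := (crossTermsVanish_iff_spectralPlusOne hρ h).1 hcross j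
      rw [(h.2.2.1 j).isPOVM.canonicalRandomness_eq_zero hR hρ hdec hfix, mul_zero]
    · rintro x ⟨l, r, N, h, rfl⟩
      exact hnonneg h

end Characterization

end POVMRandomness

theorem corollary1 {d m : ℕ} [NeZero m]
    (M : Fin m → Matrix (Fin d) (Fin d) ℂ) (hM : POVMRandomness.IsPOVM M)
    (ρ : Matrix (Fin d) (Fin d) ℂ) (hρ : POVMRandomness.IsState ρ)
    (R : Matrix (Fin d × Fin m) (Fin d × Fin m) ℂ →
      (Fin m → Matrix (Fin d × Fin m) (Fin d × Fin m) ℂ) → ℝ)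
    (hR : R = POVMRandomness.Rc ∨ R = POVMRandomness.Rq) :
    (POVMRandomness.Rcf R ρ M = 0 ↔
      ∃ (l : ℕ) (r : Fin l → ℝ) (N : Fin l → Fin m → Matrix (Fin d) (Fin d) ℂ),
        POVMRandomness.IsExtremalDecomposition M r N ∧ POVMRandomness.CrossTermsVanish ρ N) ∧
    (POVMRandomness.Rcf R ρ M = 0 ↔
      ∃ (l : ℕ) (r : Fin l → ℝ) (N : Fin l → Fin m → Matrix (Fin d) (Fin d) ℂ),
        POVMRandomness.IsExtremalDecomposition M r N ∧ POVMRandomness.SpectralPlusOne ρ N) ∧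
    (∀ (l : ℕ) (r : Fin l → ℝ) (N : Fin l → Fin m → Matrix (Fin d) (Fin d) ℂ),
      POVMRandomness.IsExtremalDecomposition M r N →
        (POVMRandomness.CrossTermsVanish ρ N ↔ POVMRandomness.SpectralPlusOne ρ N)) := by
  have hcross := POVMRandomness.Rcf_eq_zero_iff_crossTermsVanish hR hρ hM
  refine ⟨hcross, hcross.trans ⟨?_, ?_⟩, fun l r N h =>
    POVMRandomness.crossTermsVanish_iff_spectralPlusOne hρ h⟩
  · rintro ⟨l, r, N, h, hc⟩
    exact ⟨l, r, N, h, (POVMRandomness.crossTermsVanish_iff_spectralPlusOne hρ h).1 hc⟩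
  · rintro ⟨l, r, N, h, hs⟩
    exact ⟨l, r, N, h, (POVMRandomness.crossTermsVanish_iff_spectralPlusOne hρ h).2 hs⟩
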